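/- **Conventions.** Graphs are finite and simple; $N[u]$ is the closed neighbourhood of $u$. A dominating multiset of size $k$ of $G$ is a multiset of $k$ vertices ("tokens") whose underlying set $D$ satisfies $\bigcup_{d\in D}N[d]=V$. A token slide replaces one occurrence of a vertex $u$ by a neighbour $v$ of $u$. $D_{\sf s}$ is reconfigurable into $D_{\sf t}$ if there is a sequence of dominating multisets of size $k$ from $D_{\sf s}$ to $D_{\sf t}$ in which consecutive multisets differ by one token slide. The problem DSR$_{\sf TS}$ asks, given $G$ and two dominating multisets $D_{\sf s},D_{\sf t}$ of size $k$ of $G$, whether $D_{\sf s}$ is reconfigurable into $D_{\sf t}$. A maximum neighbour of $u$ in a graph $H$ is a vertex $v\in N_H[u]$ with $N_H[w]\subseteq N_H[v]$ for all $w\in N_H[u]$. A maximum neighbourhood ordering (mno) of $G$ is an ordering $v_1,\dots,v_n$ of its vertices such that each $v_i$ has a maximum neighbour in $G_i=G[\{v_i,\dots,v_n\}]$; $G$ is dually chordal if it has an mno. A proper mno is an mno together with a map $mn:V\to V$ such that $mn(v_i)$ is a maximum neighbour of $v_i$ in $G_i$ for all $i$, and $mn(v_i)\ne v_i$ for all $i<n$.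 For a proper mno, the algorithm MDS starts with all vertices labelled Bounded and $C=T=\emptyset$, and for $i=1,\dots,n$ does the following: if $v_i$ is Bounded, label $mn(v_i)$ Required, add $v_i$ to $T$, and label Free every vertex of $N[mn(v_i)]$ that is not Required; then, if $v_i$ is Required, add $v_i$ to $C$. A dominating set $C$ is triggered with triggering vertices $T=\{t_1,\dots,t_m\}$ (listed in increasing order) if $C=\{c_1,\dots,c_m\}$ with distinct $c_i=mn(t_i)$, and $t_i$ is the least vertex outside $N[c_1]\cup\dots\cup N[c_{i-1}]$, for all $i$. **Theorem.** 1. DSR$_{\sf TS}$ can be solved in quadratic time on dually chordal graphs: there are a constant $c$ and a program for a random access machine (instructions: constant, copy, add one, subtract one, reading and writing array cells, jumps that compare registers; unit cost) that, given a dually chordal graph on $n$ vertices by a list of its edges and two dominating multisets of size $k$ by lists of their elements, stops after at most $c\,(n^2+kn+1)$ steps with the correct answer. This is $O(n^2)$ for $k=O(n)$, in particular for dominating sets without repeated elements. 2. Let $G$ be a dually chordal graph on $n$ vertices, and $D_{\sf s},D_{\sf t}$ dominating multisets of size $k$ of $G$. Then $D_{\sf s}$ is reconfigurable into $D_{\sf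 t}$ if and only if $D_{\sf s}$ and $D_{\sf t}$ have the same number of tokens on each connected component of $G$; in this case at most $4kn$ slides suffice. 3. Every connected dually chordal graph has a proper mno. For every proper mno of a connected graph $G$, MDS computes a triggered dominating set $C$, with its set $T$ of triggering vertices, and $C$ has minimum size $\gamma$ among the dominating sets of $G$. Every dominating multiset $D$ of size $k$ is reconfigurable, by at most $2\gamma$ slides, into one that contains $C$; and for every vertex $v$ of minimum eccentricity $\epsilon(v)$, $D$ is reconfigurable, by at most $2\gamma+(k-\gamma)\,\epsilon(v)$ slides, into the multiset that consists of $C$ and $k-\gamma$ further tokens on $v$. 4. Trees and interval graphs (intersection graphs of finite families of closed real intervals) are dually chordal. -/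

import Mathlib

namespace DomReconf

section Graphs

variable {V : Type*}

/-- The closed neighbourhood `N[u]` of a vertex. -/
def closedNbhd (G : SimpleGraph V) (u : V) : Set V := {w | w = u ∨ G.Adj u w}

/-- `S` is a dominating set of `G`: every vertex lies in `N[d]` for some `d` in `S`. -/
def IsDominating (G : SimpleGraph V) (S : Set V) : Prop :=
  ∀ v, ∃ d ∈ S, v ∈ closedNbhd G d

/-- A multiset of tokens of size `k` whose underlying set is dominating. -/
def IsDomMultiset (G : SimpleGraph V) (k : ℕ) (D : Multiset V) : Prop :=
  D.card = k ∧ IsDominating G {v | v ∈ D}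

/-- One token slide: a token on `u` moves along an edge `uv`. -/
def Slide (G : SimpleGraph V) (D D' : Multiset V) : Prop :=
  ∃ (u v : V) (R : Multiset V), G.Adj u v ∧ D = u ::ₘ R ∧ D' = v ::ₘ R

/-- There is a token sliding sequence from `D` to `D'` with exactly `l` slides, all of whose terms
are dominating multisets of size `k`. Only the terms `seq 0, …, seq l` matter. -/
def ReconfIn (G : SimpleGraph V) (k l : ℕ) (D D' : Multiset V) : Prop :=
  ∃ seq : ℕ → Multiset V, seq 0 = D ∧ seq l = D' ∧
    (∀ i ≤ l, IsDomMultiset G k (seq i)) ∧ ∀ i < l, Slide G (seq i) (seq (i + 1))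

/-- `D` is reconfigurable into `D'` by token sliding through dominating multisets of size `k`. -/
def Reconf (G : SimpleGraph V) (k : ℕ) (D D' : Multiset V) : Prop :=
  ∃ l, ReconfIn G k l D D'

open Classical in
/-- The number of tokens of `D` on a connected component. -/
noncomputable def tokensOn (G : SimpleGraph V) (D : Multiset V) (c : G.ConnectedComponent) : ℕ :=
  D.countP (fun v => G.connectedComponentMk v = c)

/-- `v` is a maximum neighbour of `u` in the induced subgraph `G[S]`: `v` is in the closed
neighbourhood of `u` in `G[S]`, and contains in its closed neighbourhood the closed neighbourhood
in `G[S]` of every member of the closed neighbourhood of `u` in `G[S]`. -/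
def IsMaxNeighborIn (G : SimpleGraph V) (S : Set V) (u v : V) : Prop :=
  u ∈ S ∧ v ∈ closedNbhd G u ∩ S ∧
    ∀ w ∈ closedNbhd G u ∩ S, closedNbhd G w ∩ S ⊆ closedNbhd G v ∩ S

/-- For an ordering `σ 0, σ 1, …` of the vertices, the vertices from position `i` on. -/
def tailSet {n : ℕ} (σ : Fin n ≃ V) (i : Fin n) : Set V := {x | i ≤ σ.symm x}

/-- A maximum neighbourhood ordering: `σ i` has a maximum neighbour in the subgraph induced by
the vertices from position `i` on. -/
def IsMNO (G : SimpleGraph V) {n : ℕ} (σ : Fin n ≃ V) : Prop :=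
  ∀ i, ∃ v, IsMaxNeighborIn G (tailSet σ i) (σ i) v

/-- A dually chordal graph: a finite graph with a maximum neighbourhood ordering. -/
def IsDuallyChordal (G : SimpleGraph V) : Prop :=
  ∃ (n : ℕ) (σ : Fin n ≃ V), IsMNO G σ

/-- `mn` associates with each vertex of the ordering `σ` a maximum neighbour, different from the
vertex itself unless the vertex is the last one. (In particular `σ` is a maximum neighbourhood
ordering.) -/
def IsMaxNeighborMap (G : SimpleGraph V) {n : ℕ} (σ : Fin n ≃ V) (mn : V → V) : Prop :=
  (∀ i, IsMaxNeighborIn G (tailSet σ i) (σ i) (mn (σ i))) ∧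
    ∀ i : Fin n, (i : ℕ) + 1 < n → mn (σ i) ≠ σ i

/-- An interval graph: an intersection graph of closed real intervals `[l v, r v]`. -/
def IsIntervalGraph (G : SimpleGraph V) : Prop :=
  ∃ l r : V → ℝ, (∀ v, l v ≤ r v) ∧
    ∀ u v, G.Adj u v ↔ u ≠ v ∧ (Set.Icc (l u) (r u) ∩ Set.Icc (l v) (r v)).Nonempty

end Graphs

section MDS

variable {V : Type*}

/-- The labels used by the algorithm. -/
inductive Label
  | bounded
  | free
  | required

/-- The state of the algorithm: the labelling, the set `C` under construction, and the set `T` of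
triggering vertices. -/
structure MDSState (V : Type*) where
  label : V → Label
  C : Finset V
  T : Finset V

open Classical in
/-- If `v` is bounded, label `mn v` required and every vertex of `N[mn v]` that is not required
free, and add `v` to `T`. -/
noncomputable def MDSState.trigger (G : SimpleGraph V) (mn : V → V) (s : MDSState V) (v : V) :
    MDSState V :=
  if s.label v = Label.bounded then
    { label := fun u =>
        if u = mn v ∨ s.label u = Label.required then Label.required
        else if u ∈ closedNbhd G (mn v) then Label.free
        else s.label u
      C := s.C
      T := insert v s.T }
  else s

open Classical in
/-- If `v` is required, add it to `C`. -/
noncomputable def MDSState.collect (s : MDSState V) (v : V) : MDSState V :=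
  if s.label v = Label.required then { s with C := insert v s.C } else s

/-- The final state of the algorithm: all vertices are bounded at first, and are treated in the
given order. -/
noncomputable def MDS (G : SimpleGraph V) {n : ℕ} (σ : Fin n ≃ V) (mn : V → V) : MDSState V :=
  (List.ofFn σ).foldl (fun s v => (s.trigger G mn v).collect v)
    { label := fun _ => Label.bounded, C := ∅, T := ∅ }

/-- `C` is a triggered dominating set with triggering vertices `T`: `T` is listed increasingly as
`t 0, t 1, …`, `C` consists of the distinct vertices `mn (t 0), mn (t 1), …`, and `t i` is the
least vertex that is not dominated by the `mn (t j)` with `j < i`. -/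
def IsTriggered (G : SimpleGraph V) {n : ℕ} (σ : Fin n ≃ V) (mn : V → V) (C T : Finset V) : Prop :=
  IsDominating G (C : Set V) ∧
    ∃ (m : ℕ) (t : Fin m → V),
      StrictMono (fun i => σ.symm (t i)) ∧ Function.Injective (fun i => mn (t i)) ∧
      (T : Set V) = Set.range t ∧ (C : Set V) = Set.range (fun i => mn (t i)) ∧
      ∀ i, (∀ j < i, t i ∉ closedNbhd G (mn (t j))) ∧
        ∀ x, (∀ j < i, x ∉ closedNbhd G (mn (t j))) → σ.symm (t i) ≤ σ.symm x

/-- A dominating set of minimum size. -/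
def IsMinDominating (G : SimpleGraph V) (C : Finset V) : Prop :=
  IsDominating G (C : Set V) ∧ ∀ D : Finset V, IsDominating G (D : Set V) → C.card ≤ D.card

end MDS

section Machine

/-- Instructions of a random access machine. Registers and arrays are numbered; every register
and every array cell holds a natural number. Numbers change by at most one in a step, so that
during `t` steps no number exceeds the largest number of the input and the program by more
than `t`: unit cost is an honest measure of time. -/
inductive Instr
  /-- register `r` becomes the constant `c` -/
  | const (r c : ℕ)
  /-- register `r` becomes the content of register `s` -/
  | copy (r s : ℕ)
  /-- add one to register `r` -/
  | succ (r : ℕ)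
  /-- subtract one from register `r` (zero stays zero) -/
  | pred (r : ℕ)
  /-- register `r` becomes the cell of array `a` whose index is in register `i` -/
  | load (r a i : ℕ)
  /-- the cell of array `a` whose index is in register `i` becomes the content of register `r` -/
  | store (a i r : ℕ)
  /-- go to line `l` -/
  | jump (l : ℕ)
  /-- go to line `l` if registers `r` and `s` have the same content -/
  | jumpEq (r s l : ℕ)
  /-- go to line `l` if the content of register `r` is less than that of register `s` -/
  | jumpLt (r s l : ℕ)
  /-- stop with answer `b` -/
  | halt (b : Bool)

/-- A program is a finite list of instructions, with lines numbered from `0`. -/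
abbrev Program := List Instr

/-- A configuration: the current line, the registers, and the cells of the arrays. -/
structure Config where
  line : ℕ
  reg : ℕ → ℕ
  mem : ℕ → ℕ → ℕ

/-- The effect of one instruction. -/
def Instr.exec (x : Instr) (c : Config) : Config :=
  match x with
  | .const r a => ⟨c.line + 1, Function.update c.reg r a, c.mem⟩
  | .copy r s => ⟨c.line + 1, Function.update c.reg r (c.reg s), c.mem⟩
  | .succ r => ⟨c.line + 1, Function.update c.reg r (c.reg r + 1), c.mem⟩
  | .pred r => ⟨c.line + 1, Function.update c.reg r (c.reg r - 1), c.mem⟩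
  | .load r a i => ⟨c.line + 1, Function.update c.reg r (c.mem a (c.reg i)), c.mem⟩
  | .store a i r =>
      ⟨c.line + 1, c.reg, Function.update c.mem a (Function.update (c.mem a) (c.reg i) (c.reg r))⟩
  | .jump l => ⟨l, c.reg, c.mem⟩
  | .jumpEq r s l => ⟨if c.reg r = c.reg s then l else c.line + 1, c.reg, c.mem⟩
  | .jumpLt r s l => ⟨if c.reg r < c.reg s then l else c.line + 1, c.reg, c.mem⟩
  | .halt _ => c

/-- One step; a configuration whose line is not a line of the program is stuck. -/
def step (P : Program) (c : Config) : Config :=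
  match P[c.line]? with
  | some x => x.exec c
  | none => c

/-- Started in `c`, the program reaches an instruction `halt b` after `t` steps. -/
def HaltsIn (P : Program) (c : Config) (t : ℕ) (b : Bool) : Prop :=
  P[((step P)^[t] c).line]? = some (Instr.halt b)

/-- `E` lists the edges of `G`, each exactly once, in any order and with any order of the two
ends of an edge. -/
def ListsEdges {n : ℕ} (G : SimpleGraph (Fin n)) (E : List (Fin n × Fin n)) : Prop :=
  (E.map fun e => s(e.1, e.2)).Nodup ∧ ∀ x, x ∈ (E.map fun e => s(e.1, e.2)) ↔ x ∈ G.edgeSet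

/-- A list of numbers as an array, filled up with zeros. -/
def arrayOf (L : List ℕ) : ℕ → ℕ := fun i => L.getD i 0

/-- The initial configuration on a graph with vertices `0, …, n - 1` and edge list `E`, and two
lists `S`, `T` of tokens: registers `0`, `1`, `2` hold the number of vertices, of edges, and of
tokens of `S`; arrays `0` and `1` hold the two ends of the edges, arrays `2` and `3` hold the
tokens of `S` and `T`; every other register and cell holds zero. -/
def inputConfig (n : ℕ) (E : List (Fin n × Fin n)) (S T : List (Fin n)) : Config where
  line := 0
  reg := arrayOf [n, E.length, S.length]
  mem := fun a =>
    if a = 0 then arrayOf (E.map fun e => (e.1 : ℕ))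
    else if a = 1 then arrayOf (E.map fun e => (e.2 : ℕ))
    else if a = 2 then arrayOf (S.map fun v => (v : ℕ))
    else if a = 3 then arrayOf (T.map fun v => (v : ℕ))
    else fun _ => 0

end Machine

end DomReconf

namespace DomReconf

/-! ### Reconfiguration sequences and movement of surplus tokens. -/

section Sequences

variable {V : Type*} {G : SimpleGraph V}

/-! A slide never leaves a connected component, so equal token numbers on components are necessary.
For sufficiency, both multisets are moved onto a common canonical dominating set `C`; once `C` is
occupied, the remaining tokens are free and walk inside their components to matching targets. Slides
are reversible, so the two halves compose.

The canonical set is greedy. If `t` is the least vertex not yet dominated, put `mn t` into `C`. By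
`IsLocallyProper.mem_closedNbhd_of_common`, any vertex `d` that dominates `t` has all its neighbours
from `t` on inside the closed neighbourhood of `mn t`. All undominated vertices lie from `t` on, so
the token on `d` may be replaced by one on `mn t`, and `IsLocallyProper.exists_reconfIn_step` does
this by at most two slides. One round per element of `C` puts `C` inside an arbitrary dominating
multiset; in particular no dominating set is smaller than `C`. The invariant `MDSInvariant` shows
that the labelling algorithm performs exactly this greedy choice.

The argument uses only orderings in which a vertex with a later neighbour is not its own chosen
maximum neighbour. `exists_perm_allSuffixes_proper` makes any maximum neighbourhood ordering into
one, by postponing the offending vertices. This also covers disconnected graphs; in a connected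
graph only the last vertex can then be its own choice.

Deciding reconfigurability thus amounts to counting tokens on components. The program merges
component labels edge by edge: each relabelling pass is linear in the number of vertices and
destroys a label, so there are fewer passes than vertices and the total time is quadratic. -/

theorem ReconfIn.refl {k : ℕ} {D : Multiset V} (h : IsDomMultiset G k D) : ReconfIn G k 0 D D :=
  ⟨fun _ => D, rfl, rfl, fun _ _ => h, fun i hi => absurd hi (Nat.not_lt_zero i)⟩

theorem ReconfIn.left {k l : ℕ} {D D' : Multiset V} (h : ReconfIn G k l D D') :
    IsDomMultiset G k D := by
  obtain ⟨s, h0, -, hd, -⟩ := h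
  exact h0 ▸ hd 0 (Nat.zero_le _)

theorem ReconfIn.right {k l : ℕ} {D D' : Multiset V} (h : ReconfIn G k l D D') :
    IsDomMultiset G k D' := by
  obtain ⟨s, -, h1, hd, -⟩ := h
  exact h1 ▸ hd l le_rfl

theorem ReconfIn.single {k : ℕ} {D D' : Multiset V} (h : IsDomMultiset G k D)
    (h' : IsDomMultiset G k D') (hs : Slide G D D') : ReconfIn G k 1 D D' := by
  refine ⟨fun i => if i = 0 then D else D', by simp, by simp, fun i _ => ?_, fun i hi => ?_⟩
  · dsimp only
    split_ifs
    exacts [h, h']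
  · obtain rfl : i = 0 := by omega
    simpa using hs

theorem ReconfIn.trans {k a b : ℕ} {D D' D'' : Multiset V} (h : ReconfIn G k a D D')
    (h' : ReconfIn G k b D' D'') : ReconfIn G k (a + b) D D'' := by
  obtain ⟨s, s0, s1, sd, ss⟩ := h
  obtain ⟨t, t0, t1, td, ts⟩ := h'
  refine ⟨fun i => if i ≤ a then s i else t (i - a), by simpa using s0, ?_, fun i hi => ?_,
    fun i hi => ?_⟩
  · dsimp only
    split_ifs with hb
    · obtain rfl : b = 0 := by omega
      simpa [s1, ← t0] using t1
    · simpa using t1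
  · dsimp only
    split_ifs with hb
    exacts [sd i hb, td _ (by omega)]
  · rcases lt_trichotomy i a with hia | rfl | hia
    · simpa [hia.le, Nat.succ_le_of_lt hia] using ss i hia
    · have := ts 0 (by omega)
      simpa [s1, ← t0] using this
    · have := ts (i - a) (by omega)
      simpa [hia.not_ge, show ¬ (i + 1 ≤ a) by omega, show i + 1 - a = i - a + 1 by omega] using this

theorem Slide.symm {D D' : Multiset V} (h : Slide G D D') : Slide G D' D := by
  obtain ⟨u, v, R, ha, rfl, rfl⟩ := h
  exact ⟨v, u, R, ha.symm, rfl, rfl⟩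

theorem ReconfIn.symm {k l : ℕ} {D D' : Multiset V} (h : ReconfIn G k l D D') :
    ReconfIn G k l D' D := by
  obtain ⟨s, s0, s1, sd, ss⟩ := h
  refine ⟨fun i => s (l - i), by simpa using s1, by simpa using s0, fun i _ => sd _ (by omega),
    fun i hi => ?_⟩
  have := (ss (l - (i + 1)) (by omega)).symm
  rwa [show l - (i + 1) + 1 = l - i by omega] at this

theorem Slide.tokensOn_eq {D D' : Multiset V} (h : Slide G D D') (c : G.ConnectedComponent) :
    tokensOn G D c = tokensOn G D' c := by
  classical
  obtain ⟨u, v, R, ha, rfl, rfl⟩ := h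
  have : G.connectedComponentMk u = G.connectedComponentMk v :=
    SimpleGraph.ConnectedComponent.sound ha.reachable
  simp only [tokensOn, Multiset.countP_cons]
  exact congrArg _ (if_congr (by rw [this]) rfl rfl)

theorem ReconfIn.tokensOn_eq {k l : ℕ} {D D' : Multiset V} (h : ReconfIn G k l D D')
    (c : G.ConnectedComponent) : tokensOn G D c = tokensOn G D' c := by
  obtain ⟨s, rfl, rfl, -, ss⟩ := h
  have : ∀ i ≤ l, tokensOn G (s 0) c = tokensOn G (s i) c := by
    intro i
    induction i with
    | zero => simp
    | succ i ih => exact fun hi => (ih (by omega)).trans ((ss i (by omega)).tokensOn_eq c)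
  exact this l le_rfl

theorem IsDominating.mono {S T : Set V} (h : IsDominating G S) (hST : S ⊆ T) :
    IsDominating G T := fun v =>
  let ⟨d, hd, hv⟩ := h v
  ⟨d, hST hd, hv⟩

/-- A token that is not needed for domination moves along a walk. -/
theorem reconfIn_walk {S : Multiset V} (hS : IsDominating G {v | v ∈ S}) {u v : V}
    (p : G.Walk u v) : ReconfIn G (S.card + 1) p.length (u ::ₘ S) (v ::ₘ S) := by
  have hd : ∀ w, IsDomMultiset G (S.card + 1) (w ::ₘ S) := fun w =>
    ⟨by simp, hS.mono fun x hx => Multiset.mem_cons_of_mem hx⟩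
  induction p with
  | nil => exact ReconfIn.refl (hd _)
  | cons h p ih =>
    rw [SimpleGraph.Walk.length_cons, add_comm p.length]
    exact (ReconfIn.single (hd _) (hd _) ⟨_, _, S, h, rfl, rfl⟩).trans ih

/-- Tokens in excess of a dominating multiset are moved within their components, each within
distance `m`. -/
theorem exists_reconfIn_of_rel {C R R' : Multiset V} {m : ℕ} (hC : IsDominating G {v | v ∈ C})
    (h : Multiset.Rel (fun u v => ∃ p : G.Walk u v, p.length ≤ m) R R') :
    ∃ l ≤ R.card * m, ReconfIn G (C.card + R.card) l (C + R) (C + R') := by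
  induction h generalizing C with
  | zero => exact ⟨0, by simp, ReconfIn.refl ⟨by simp, by simpa using hC⟩⟩
  | @cons a b as bs hab _ ih =>
    obtain ⟨p, hp⟩ := hab
    -- The token that has arrived at `b` is counted as part of the fixed dominating multiset while
    -- the others move.
    obtain ⟨l, hl, hr⟩ := ih (C := b ::ₘ C) (hC.mono fun x hx => Multiset.mem_cons_of_mem hx)
    have h1 := reconfIn_walk (S := C + as) (hC.mono fun x hx => by simp_all) p
    refine ⟨p.length + l, by simp [add_mul]; omega, ?_⟩
    simp only [Multiset.card_add, Multiset.card_cons, Multiset.cons_add, Multiset.add_cons] at *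
    rw [← add_assoc]
    refine h1.trans ?_
    convert hr using 1
    omega

end Sequences

/-! ### Proper orderings; interval graphs and trees. -/

section Orders

variable {V : Type*} {G : SimpleGraph V}

/-- Every suffix `v :: l'` of the list satisfies `Q v l'`. -/
def AllSuffixes (Q : V → List V → Prop) (l : List V) : Prop := ∀ v l', v :: l' <:+ l → Q v l'

theorem allSuffixes_nil (Q : V → List V → Prop) : AllSuffixes Q [] := by
  intro v l' h
  simp at h

theorem allSuffixes_cons {Q : V → List V → Prop} {v : V} {l : List V} :
    AllSuffixes Q (v :: l) ↔ Q v l ∧ AllSuffixes Q l := by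
  constructor
  · exact fun h => ⟨h v l List.suffix_rfl, fun w l' hs => h w l' (hs.trans (List.suffix_cons v l))⟩
  · rintro ⟨h1, h2⟩ w l' hs
    rcases List.suffix_cons_iff.1 hs with h | h
    · obtain ⟨rfl, rfl⟩ := List.cons.inj h
      exact h1
    · exact h2 w l' h

/-- `u` is a maximum neighbour of `v` among the vertices of `v :: l`. -/
abbrev MaxNeighborOn (G : SimpleGraph V) (v : V) (l : List V) (u : V) : Prop :=
  IsMaxNeighborIn G {x | x ∈ v :: l} v u

/-- `v` has a maximum neighbour among the vertices of `v :: l` that is different from `v` unless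
`v` has no other neighbour. -/
def HasProperMaxNeighbor (G : SimpleGraph V) (v : V) (l : List V) : Prop :=
  ∃ u, MaxNeighborOn G v l u ∧ (u = v → ∀ w ∈ l, ¬ G.Adj v w)

theorem closedNbhd_comm {u v : V} : u ∈ closedNbhd G v ↔ v ∈ closedNbhd G u := by
  simp [closedNbhd, eq_comm, G.adj_comm]

theorem self_mem_closedNbhd (u : V) : u ∈ closedNbhd G u := Or.inl rfl

/-- A vertex `v` that is its own maximum neighbour is adjacent to all other vertices of its
component in the induced subgraph. Placed last, it serves as maximum neighbour for every vertex of
this component, and the vertices of other components do not notice it. -/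
theorem allSuffixes_proper_append {v : V} {l m : List V} (hlm : ∀ x ∈ m, x ∈ l)
    (hv : MaxNeighborOn G v l v) (h : AllSuffixes (HasProperMaxNeighbor G) m) (hm : v ∉ m) :
    AllSuffixes (HasProperMaxNeighbor G) (m ++ [v]) := by
  induction m with
  | nil =>
    refine allSuffixes_cons.2 ⟨⟨v, ⟨by simp, by simp [closedNbhd], ?_⟩, by simp⟩,
      allSuffixes_nil _⟩
    rintro w ⟨-, hw⟩
    simp at hw
    simp [hw]
  | cons w m ih =>
    obtain ⟨⟨u, ⟨-, ⟨hu1, hu2⟩, hu⟩, hu'⟩, h2⟩ := allSuffixes_cons.1 h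
    rw [List.cons_append]
    refine allSuffixes_cons.2 ⟨?_, ih (fun x hx => hlm x (by simp [hx])) h2 (by simp_all)⟩
    have hsub : ∀ x, x ∈ w :: (m ++ [v]) → x ∈ v :: l := by
      intro x hx
      simp only [List.mem_cons, List.mem_append, List.not_mem_nil, or_false] at hx ⊢
      rcases hx with rfl | hx | rfl
      · exact Or.inr (hlm _ (by simp))
      · exact Or.inr (hlm _ (by simp [hx]))
      · exact Or.inl rfl
    -- The closed neighbourhood of `v` is closed under adjacency, that is, it is a whole component.
    have hcl : ∀ x y, x ∈ closedNbhd G v → x ∈ w :: (m ++ [v]) → y ∈ closedNbhd G x →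
        y ∈ w :: (m ++ [v]) → y ∈ closedNbhd G v := fun x y hx hx' hy hy' =>
      (hv.2.2 x ⟨hx, hsub x hx'⟩ ⟨hy, hsub y hy'⟩).1
    have hwv : w ≠ v := by rintro rfl; simp at hm
    by_cases hwa : w ∈ closedNbhd G v
    · refine ⟨v, ⟨by simp, ⟨closedNbhd_comm.1 hwa, by simp⟩, ?_⟩, fun h => absurd h.symm hwv⟩
      rintro x ⟨hx, hx'⟩ y ⟨hy, hy'⟩
      exact ⟨hcl x y (hcl w x hwa (by simp) hx hx') hx' hy hy', hy'⟩
    · refine ⟨u, ⟨by simp, ⟨hu1, by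
        simp only [Set.mem_ofPred_eq, List.mem_cons, List.mem_append] at hu2 ⊢
        tauto⟩, ?_⟩, ?_⟩
      · rintro x ⟨hx, hx'⟩ y ⟨hy, hy'⟩
        have hxv : x ∉ closedNbhd G v := fun hc =>
          hwa (hcl x w hc hx' (closedNbhd_comm.1 hx) (by simp))
        have hyv : y ≠ v := by
          rintro rfl
          exact hxv (closedNbhd_comm.1 hy)
        have hxv' : x ≠ v := by
          rintro rfl
          exact hxv (self_mem_closedNbhd _)
        refine ⟨(hu x ⟨hx, ?_⟩ ⟨hy, ?_⟩).1, hy'⟩ <;>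
          simp only [Set.mem_ofPred_eq, List.mem_cons, List.mem_append, List.not_mem_nil,
            or_false] at hx' hy' ⊢ <;>
          tauto
      · intro huw x hx hadj
        simp only [List.mem_append, List.mem_cons, List.not_mem_nil, or_false] at hx
        rcases hx with hx | rfl
        · exact hu' huw x hx hadj
        · exact hwa (Or.inr hadj.symm)

/-- Induction from the back: a vertex that is its own maximum neighbour is moved to the end, any
other vertex stays in front. Being a maximum neighbour depends only on the set of later vertices, so
permuting these is harmless. -/
theorem exists_perm_allSuffixes_proper {l : List V} (hl : l.Nodup)
    (h : AllSuffixes (fun v l' => ∃ u, MaxNeighborOn G v l' u) l) :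
    ∃ m, m.Perm l ∧ AllSuffixes (HasProperMaxNeighbor G) m := by
  induction l with
  | nil => exact ⟨[], List.Perm.refl _, allSuffixes_nil _⟩
  | cons v l ih =>
    obtain ⟨⟨u, hu⟩, h2⟩ := allSuffixes_cons.1 h
    obtain ⟨m, hm, hm'⟩ := ih hl.of_cons h2
    by_cases huv : u = v
    · subst huv
      exact ⟨m ++ [u], (List.perm_append_singleton _ _).trans (hm.cons u),
        allSuffixes_proper_append (fun x hx => hm.mem_iff.1 hx) hu hm'
          (fun hc => (List.nodup_cons.1 hl).1 (hm.mem_iff.1 hc))⟩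
    · have : {x | x ∈ v :: m} = {x | x ∈ v :: l} := by
        ext x
        simp [hm.mem_iff]
      exact ⟨v :: m, hm.cons v, allSuffixes_cons.2
        ⟨⟨u, by rwa [MaxNeighborOn, this], fun h => absurd h huv⟩, hm'⟩⟩

theorem mem_drop_ofFn {n : ℕ} (σ : Fin n ≃ V) (i : Fin n) (x : V) :
    x ∈ (List.ofFn σ).drop i ↔ x ∈ tailSet σ i := by
  rw [List.mem_drop_iff_getElem]
  constructor
  · rintro ⟨j, hj, rfl⟩
    rw [tailSet, Set.mem_ofPred_eq, List.getElem_ofFn, Equiv.symm_apply_apply]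
    exact Nat.le_add_right _ _
  · intro hx
    refine ⟨σ.symm x - i, ?_, ?_⟩
    · simp only [List.length_ofFn]
      omega
    · have : (i : ℕ) + ((σ.symm x : ℕ) - i) = σ.symm x := Nat.add_sub_cancel' hx
      simp [this]

/-- A proper ordering of a possibly disconnected graph: only a vertex that has no later neighbours
may be its own chosen maximum neighbour. -/
def IsLocallyProper (G : SimpleGraph V) {n : ℕ} (σ : Fin n ≃ V) (mn : V → V) : Prop :=
  (∀ i, IsMaxNeighborIn G (tailSet σ i) (σ i) (mn (σ i))) ∧
    ∀ i j, mn (σ i) = σ i → i < j → ¬ G.Adj (σ i) (σ j)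

theorem IsMaxNeighborMap.isLocallyProper {n : ℕ} {σ : Fin n ≃ V} {mn : V → V}
    (h : IsMaxNeighborMap G σ mn) : IsLocallyProper G σ mn :=
  ⟨h.1, fun i j hi hij => absurd hi (h.2 i (by have := j.2; rw [Fin.lt_def] at hij; omega))⟩

theorem allSuffixes_ofFn {n : ℕ} {σ : Fin n ≃ V} {Q : V → List V → Prop}
    (h : ∀ i : Fin n, Q (σ i) ((List.ofFn σ).drop (i + 1))) : AllSuffixes Q (List.ofFn σ) := by
  rintro v l' ⟨m, hm⟩
  have hlen : m.length < n := by
    have := congrArg List.length hm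
    simp at this
    omega
  have h1 : (List.ofFn σ)[m.length]'(by simpa using hlen) = v := by
    simp [← hm]
  have h2 : (List.ofFn σ).drop (m.length + 1) = l' := by
    simp [← hm]
  have := h ⟨m.length, hlen⟩
  rw [List.getElem_ofFn] at h1
  rwa [h1, h2] at this

theorem setOf_mem_cons_drop {n : ℕ} (σ : Fin n ≃ V) (i : Fin n) :
    {x | x ∈ σ i :: (List.ofFn σ).drop (i + 1)} = tailSet σ i := by
  ext x
  rw [← mem_drop_ofFn, List.drop_eq_getElem_cons (i := i) (by simp)]
  simp

theorem exists_equiv_ofFn {l : List V} (hl : l.Nodup) (hmem : ∀ x, x ∈ l) :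
    ∃ σ : Fin l.length ≃ V, List.ofFn σ = l := by
  classical
  exact ⟨hl.getEquivOfForallMemList l hmem, List.ofFn_getElem⟩

theorem IsDuallyChordal.exists_isLocallyProper (h : IsDuallyChordal G) :
    ∃ (n : ℕ) (σ : Fin n ≃ V) (mn : V → V), IsLocallyProper G σ mn := by
  obtain ⟨n, σ, hσ⟩ := h
  obtain ⟨m, hm, hm'⟩ := exists_perm_allSuffixes_proper (G := G)
    (List.nodup_ofFn.2 σ.injective) (allSuffixes_ofFn fun i => by
      simpa only [MaxNeighborOn, setOf_mem_cons_drop] using hσ i)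
  obtain ⟨τ, hτ⟩ := exists_equiv_ofFn (hm.nodup_iff.2 (List.nodup_ofFn.2 σ.injective))
    (fun x => hm.mem_iff.2 (by simpa [List.mem_ofFn] using σ.surjective x))
  rw [← hτ] at hm'
  have key : ∀ i, ∃ u, IsMaxNeighborIn G (tailSet τ i) (τ i) u ∧
      (u = τ i → ∀ w ∈ (List.ofFn τ).drop (i + 1), ¬ G.Adj (τ i) w) := by
    intro i
    have := hm' (τ i) ((List.ofFn τ).drop (i + 1)) (by
      have := List.drop_suffix i (List.ofFn τ)
      rwa [List.drop_eq_getElem_cons (by simp), List.getElem_ofFn] at this)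
    simpa only [HasProperMaxNeighbor, MaxNeighborOn, setOf_mem_cons_drop] using this
  choose f hf hf' using key
  refine ⟨_, τ, fun v => f (τ.symm v), fun i => by simpa using hf i, fun i j hi hij => ?_⟩
  refine hf' i (by simpa using hi) _ (List.mem_drop_iff_getElem.2 ⟨j - (i + 1), ?_, ?_⟩)
  · simp only [List.length_ofFn]
    omega
  · have : (i : ℕ) + 1 + ((j : ℕ) - (i + 1)) = j := Nat.add_sub_cancel' hij
    simp [this]

/-- A graph in which every nonempty set of vertices contains one that has a maximum neighbour in
the induced subgraph is dually chordal. -/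
theorem isDuallyChordal_of_forall_finset [Finite V]
    (h : ∀ S : Finset V, S.Nonempty → ∃ v u, IsMaxNeighborIn G (S : Set V) v u) :
    IsDuallyChordal G := by
  classical
  have := Fintype.ofFinite V
  have key : ∀ (m : ℕ) (S : Finset V), S.card = m → ∃ l : List V, l.Nodup ∧ (∀ x, x ∈ l ↔ x ∈ S) ∧
      AllSuffixes (fun v l' => ∃ u, MaxNeighborOn G v l' u) l := by
    intro m
    induction m with
    | zero =>
      intro S hS
      rw [Finset.card_eq_zero] at hS
      exact ⟨[], by simp, by simp [hS], allSuffixes_nil _⟩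
    | succ m ih =>
      intro S hS
      obtain ⟨v, u, hu⟩ := h S (Finset.card_pos.1 (by omega))
      have hv : v ∈ S := hu.1
      obtain ⟨l, h1, h2, h3⟩ := ih (S.erase v) (by rw [Finset.card_erase_of_mem hv]; omega)
      have h4 : ∀ x, x ∈ v :: l ↔ x ∈ S := fun x => by
        by_cases hx : x = v <;> simp [h2, hx, hv]
      refine ⟨v :: l, List.nodup_cons.2 ⟨by simp [h2], h1⟩, h4, allSuffixes_cons.2 ⟨⟨u, ?_⟩, h3⟩⟩
      have : {x | x ∈ v :: l} = (S : Set V) := Set.ext h4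
      rwa [MaxNeighborOn, this]
  obtain ⟨l, h1, h2, h3⟩ := key _ Finset.univ rfl
  obtain ⟨σ, hσ⟩ := exists_equiv_ofFn h1 (fun x => by simp [h2])
  rw [← hσ] at h3
  refine ⟨_, σ, fun i => ?_⟩
  have := h3 (σ i) ((List.ofFn σ).drop (i + 1)) (by
      have := List.drop_suffix i (List.ofFn σ)
      rwa [List.drop_eq_getElem_cons (by simp), List.getElem_ofFn] at this)
  simpa only [MaxNeighborOn, setOf_mem_cons_drop] using this

/-- Take the interval of `v` that ends first and, among those meeting it, the interval of `u` that
ends last. Every interval of `S` ends no earlier than that of `v`, hence no earlier than `u` begins;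
and if it meets a neighbour `w` of `v`, it begins no later than `w` ends, hence no later than `u`
ends. -/
theorem IsIntervalGraph.isDuallyChordal [Finite V] (h : IsIntervalGraph G) :
    IsDuallyChordal G := by
  obtain ⟨l, r, hlr, hG⟩ := h
  have hN : ∀ u v, v ∈ closedNbhd G u ↔ l u ≤ r v ∧ l v ≤ r u := by
    intro u v
    have h1 := hlr u
    have h2 := hlr v
    simp only [closedNbhd, Set.mem_ofPred_eq, hG, Set.Icc_inter_Icc, Set.nonempty_Icc]
    constructor
    · rintro (rfl | ⟨-, h⟩)
      · exact ⟨h1, h1⟩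
      · simp at h
        exact ⟨h.2.1, h.1.2⟩
    · rintro ⟨h3, h4⟩
      by_cases huv : v = u
      · exact Or.inl huv
      · exact Or.inr ⟨Ne.symm huv, by simp [*]⟩
  refine isDuallyChordal_of_forall_finset fun S hS => ?_
  classical
  obtain ⟨v, hv, hmin⟩ := S.exists_min_image r hS
  obtain ⟨u, hu, hmax⟩ := (S.filter fun w => w ∈ closedNbhd G v).exists_max_image r
    ⟨v, Finset.mem_filter.2 ⟨hv, self_mem_closedNbhd v⟩⟩
  simp only [Finset.mem_filter] at hu hmax
  refine ⟨v, u, hv, ⟨hu.2, hu.1⟩, ?_⟩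
  rintro w ⟨hw, hwS⟩ x ⟨hx, hxS⟩
  refine ⟨?_, hxS⟩
  rw [hN] at *
  exact ⟨hu.2.2.trans (hmin x hxS), hx.2.trans (hmax w ⟨hwS, (hN _ _).2 hw⟩)⟩

/-- A vertex of `S` farthest from a root has at most one neighbour in `S`, its parent. The parent is
then a maximum neighbour; without it, the vertex is isolated in the induced subgraph. -/
theorem IsTree.isDuallyChordal [Finite V] (h : G.IsTree) : IsDuallyChordal G := by
  refine isDuallyChordal_of_forall_finset fun S hS => ?_
  classical
  obtain ⟨r, -⟩ := id hS
  obtain ⟨v, hv, hmax⟩ := S.exists_max_image (G.dist r) hS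
  have huniq : ∀ u ∈ S, ∀ w ∈ S, G.Adj v u → G.Adj v w → u = w := by
    have hpen : ∀ u ∈ S, G.Adj v u → ∀ p : G.Walk r v, p.IsPath → u = p.penultimate := by
      intro u hu hvu p hp
      obtain ⟨q, hq, hql⟩ := h.1.exists_path_of_dist r u
      refine h.2.eq_penultimate_of_adj_end hp hvu ?_
      -- If the path to `u` passed through `v`, then `u` would be farther from the root than `v`.
      refine h.2.mem_support_of_ne_mem_support_of_adj_of_isPath hp hq hvu fun hv => ?_
      have h1 := congrArg SimpleGraph.Walk.length (h.2.path_concat hp hq hvu hv)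
      rw [SimpleGraph.Walk.length_concat] at h1
      have := G.dist_le p
      have := hmax u hu
      omega
    intro u hu w hw hvu hvw
    obtain ⟨p, hp, -⟩ := h.1.exists_path_of_dist r v
    rw [hpen u hu hvu p hp, hpen w hw hvw p hp]
  by_cases hex : ∃ u ∈ S, G.Adj v u
  · obtain ⟨u, hu, hvu⟩ := hex
    refine ⟨v, u, hv, ⟨Or.inr hvu, hu⟩, ?_⟩
    rintro w ⟨hw | hw, hwS⟩
    · subst hw
      rintro x ⟨hx | hx, hxS⟩
      · exact ⟨Or.inr (hx ▸ hvu.symm), hxS⟩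
      · exact ⟨Or.inl (huniq x hxS u hu hx hvu), hxS⟩
    · rw [huniq w hwS u hu hw hvu]
  · push Not at hex
    refine ⟨v, v, hv, ⟨self_mem_closedNbhd v, hv⟩, ?_⟩
    rintro w ⟨hw | hw, hwS⟩
    · rw [hw]
    · exact absurd hw (hex w hwS)

end Orders

/-! ### The exchange argument: moving tokens onto a triggered set. -/

section Triggered

variable {V : Type*} {G : SimpleGraph V} {n : ℕ} {σ : Fin n ≃ V} {mn : V → V}

theorem IsLocallyProper.mem_closedNbhd (h : IsLocallyProper G σ mn) (v : V) :
    mn v ∈ closedNbhd G v := by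
  simpa using (h.1 (σ.symm v)).2.1.1

theorem IsLocallyProper.le (h : IsLocallyProper G σ mn) (v : V) :
    σ.symm v ≤ σ.symm (mn v) := by
  have := (h.1 (σ.symm v)).2.1.2
  rwa [Equiv.apply_symm_apply] at this

theorem IsLocallyProper.mem_closedNbhd_of_mem (h : IsLocallyProper G σ mn) {v w x : V}
    (hw : w ∈ closedNbhd G v) (hvw : σ.symm v ≤ σ.symm w) (hx : x ∈ closedNbhd G w)
    (hvx : σ.symm v ≤ σ.symm x) : x ∈ closedNbhd G (mn v) := by
  have := (h.1 (σ.symm v)).2.2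
  rw [Equiv.apply_symm_apply] at this
  exact (this w ⟨hw, hvw⟩ ⟨hx, hvx⟩).1

/-- This strict progress is what makes the inductions along `mn` terminate. -/
theorem IsLocallyProper.lt_of_mem (h : IsLocallyProper G σ mn) {v w : V}
    (hw : w ∈ closedNbhd G v) (hvw : σ.symm v < σ.symm w) : σ.symm v < σ.symm (mn v) := by
  refine lt_of_le_of_ne (h.le v) fun hc => ?_
  have h1 : v = mn v := σ.symm.injective hc
  refine h.2 (σ.symm v) (σ.symm w) (by simpa using h1.symm) hvw ?_
  rcases hw with rfl | hw
  · exact absurd hvw (lt_irrefl _)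
  · simpa using hw

/-- Whatever dominates `t`, its neighbours from `t` on are dominated by `mn t`. -/
theorem IsLocallyProper.mem_closedNbhd_of_common (h : IsLocallyProper G σ mn) {d t x : V}
    (ht : t ∈ closedNbhd G d) (hx : x ∈ closedNbhd G d) (htx : σ.symm t ≤ σ.symm x) :
    x ∈ closedNbhd G (mn t) := by
  induction hm : n - (σ.symm d : ℕ) using Nat.strong_induction_on generalizing d with
  | _ m ih =>
    rcases le_or_gt (σ.symm t) (σ.symm d) with htd | htd
    · exact h.mem_closedNbhd_of_mem (closedNbhd_comm.1 ht) htd hx htx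
    -- If `d` precedes `t`, then `mn d` is a strictly later vertex that still dominates both `t` and
    -- `x`; it takes the role of `d`.
    · have hlt := h.lt_of_mem ht htd
      have hd := (σ.symm d).2
      rw [Fin.lt_def] at hlt
      exact ih _ (by omega)
        (h.mem_closedNbhd_of_mem (self_mem_closedNbhd d) le_rfl ht htd.le)
        (h.mem_closedNbhd_of_mem (self_mem_closedNbhd d) le_rfl hx (htd.le.trans htx)) rfl

theorem adj_of_mem_closedNbhd {u v : V} (h : v ∈ closedNbhd G u) (hne : v ≠ u) : G.Adj u v :=
  h.resolve_left hne

theorem reconfIn_of_mem_closedNbhd {k : ℕ} {u v : V} {R : Multiset V}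
    (hu : IsDomMultiset G k (u ::ₘ R)) (hv : IsDomMultiset G k (v ::ₘ R))
    (h : v ∈ closedNbhd G u) : ∃ l ≤ 1, ReconfIn G k l (u ::ₘ R) (v ::ₘ R) := by
  by_cases hne : v = u
  · exact ⟨0, by omega, by subst hne; exact ReconfIn.refl hu⟩
  · exact ⟨1, le_rfl, ReconfIn.single hu hv ⟨u, v, R, adj_of_mem_closedNbhd h hne, rfl, rfl⟩⟩

/-- Only the vertices that `C` leaves undominated matter when the token on `d` is exchanged. -/
theorem IsDomMultiset.replace {k : ℕ} {C R : Multiset V} {d e : V}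
    (h : IsDomMultiset G k (d ::ₘ (C + R)))
    (he : ∀ x ∈ closedNbhd G d, (∀ c ∈ C, x ∉ closedNbhd G c) → x ∈ closedNbhd G e) :
    IsDomMultiset G k (e ::ₘ (C + R)) := by
  refine ⟨by simpa using h.1, fun x => ?_⟩
  by_cases hx : ∃ c ∈ C, x ∈ closedNbhd G c
  · obtain ⟨c, hc, hxc⟩ := hx
    exact ⟨c, by simp [hc], hxc⟩
  · push Not at hx
    obtain ⟨y, hy, hxy⟩ := h.2 x
    rcases Multiset.mem_cons.1 hy with rfl | hy
    · exact ⟨e, by simp, he x hxy hx⟩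
    · exact ⟨y, Multiset.mem_cons_of_mem hy, hxy⟩

/-- Some token outside `C`, on `d` say, dominates `t`, and replacing it by one on `mn t` preserves
domination. If `d` does not precede `t`, then `d` is equal or adjacent to `mn t`. Otherwise the
token goes through `mn d`. -/
theorem IsLocallyProper.exists_reconfIn_step (h : IsLocallyProper G σ mn) {k : ℕ}
    {C R : Multiset V} {t : V} (hD : IsDomMultiset G k (C + R))
    (ht : ∀ c ∈ C, t ∉ closedNbhd G c)
    (hmin : ∀ x, (∀ c ∈ C, x ∉ closedNbhd G c) → σ.symm t ≤ σ.symm x) :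
    ∃ l ≤ 2, ∃ R' : Multiset V, ReconfIn G k l (C + R) (mn t ::ₘ C + R') := by
  obtain ⟨d, hd, htd⟩ := hD.2 t
  have hdR : d ∈ R := (Multiset.mem_add.1 hd).resolve_left fun hdC => ht d hdC htd
  obtain ⟨R', rfl⟩ := Multiset.exists_cons_of_mem hdR
  rw [Multiset.add_cons] at hD ⊢
  have hfin : IsDomMultiset G k (mn t ::ₘ (C + R')) := hD.replace fun x hx hxC =>
    h.mem_closedNbhd_of_common htd hx (hmin x hxC)
  rcases le_or_gt (σ.symm t) (σ.symm d) with hlt | hlt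
  · obtain ⟨l, hl, hr⟩ := reconfIn_of_mem_closedNbhd hD hfin (closedNbhd_comm.1
      (h.mem_closedNbhd_of_common (self_mem_closedNbhd t) (closedNbhd_comm.1 htd) hlt))
    exact ⟨l, by omega, R', by rwa [Multiset.cons_add]⟩
  -- The stopover `mn d` is safe because all undominated vertices come after `d`. It is equal or
  -- adjacent to `mn t`, since `mn t` is reached from `d` through `t` and none of these precedes
  -- `d`.
  · have hmid : IsDomMultiset G k (mn d ::ₘ (C + R')) := hD.replace fun x hx hxC =>
      h.mem_closedNbhd_of_mem (self_mem_closedNbhd d) le_rfl hx (hlt.le.trans (hmin x hxC))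
    obtain ⟨l, hl, hr⟩ := reconfIn_of_mem_closedNbhd hD hmid (h.mem_closedNbhd d)
    obtain ⟨l', hl', hr'⟩ := reconfIn_of_mem_closedNbhd hmid hfin
      (h.mem_closedNbhd_of_mem htd hlt.le (h.mem_closedNbhd t) (hlt.le.trans (h.le t)))
    exact ⟨l + l', by omega, R', by rw [Multiset.cons_add]; exact hr.trans hr'⟩

/-- One exchange per triggering vertex; each takes its token from outside the part of `C` already
placed. -/
theorem IsTriggered.exists_reconfIn (h : IsLocallyProper G σ mn) {C T : Finset V}
    (hC : IsTriggered G σ mn C T) {k : ℕ} {D : Multiset V} (hD : IsDomMultiset G k D) :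
    ∃ l ≤ 2 * C.card, ∃ R : Multiset V, ReconfIn G k l D (C.val + R) := by
  classical
  obtain ⟨-, m, t, -, hinj, -, hCt, hmin⟩ := hC
  have key : ∀ i ≤ m, ∃ l ≤ 2 * i, ∃ R : Multiset V, ReconfIn G k l D
      (((Finset.univ.filter fun j : Fin m => (j : ℕ) < i).val.map fun j => mn (t j)) + R) := by
    intro i
    induction i with
    | zero => exact fun _ => ⟨0, le_rfl, D, by simpa using ReconfIn.refl hD⟩
    | succ i ih =>
      intro hi
      obtain ⟨l, hl, R, hR⟩ := ih (by omega)
      obtain ⟨h1, h2⟩ := hmin ⟨i, hi⟩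
      obtain ⟨l', hl', R', hR'⟩ := h.exists_reconfIn_step (t := t ⟨i, hi⟩) hR.right
        (by
          intro c hc
          obtain ⟨j, hj, rfl⟩ := Multiset.mem_map.1 hc
          exact h1 j (by simpa [Fin.lt_def] using hj))
        (fun x hx => h2 x fun j hj => hx _ (Multiset.mem_map.2 ⟨j, by
          simpa [Fin.lt_def] using hj, rfl⟩))
      have hins : (Finset.univ.filter fun j : Fin m => (j : ℕ) < i + 1) =
          insert ⟨i, hi⟩ (Finset.univ.filter fun j : Fin m => (j : ℕ) < i) := by
        ext j
        simp [Fin.ext_iff]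
        omega
      refine ⟨l + l', by omega, R', ?_⟩
      rw [hins, Finset.insert_val_of_notMem (by simp), Multiset.map_cons]
      exact hR.trans hR'
  have hval : C = Finset.univ.map ⟨fun j => mn (t j), hinj⟩ := by
    ext x
    rw [← Finset.mem_coe, hCt]
    simp
  obtain ⟨l, hl, R, hR⟩ := key m le_rfl
  refine ⟨l, by simpa [hval] using hl, R, ?_⟩
  simpa [hval] using hR

/-- Slides preserve the number of tokens, and `D` can be moved to a multiset that contains `C`. -/
theorem IsTriggered.isMinDominating (h : IsLocallyProper G σ mn) {C T : Finset V}
    (hC : IsTriggered G σ mn C T) : IsMinDominating G C := by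
  refine ⟨hC.1, fun D hD => ?_⟩
  obtain ⟨l, -, R, hR⟩ := hC.exists_reconfIn h (k := D.card) (D := D.val) ⟨rfl, hD⟩
  have := hR.right.1
  rw [Multiset.card_add, Finset.card_val] at this
  omega

end Triggered

/-! ### Correctness of the labelling algorithm. -/

section MDS

variable {V : Type*} {G : SimpleGraph V} {n : ℕ} {σ : Fin n ≃ V} {mn : V → V}

/-- The state of the algorithm after the first `i` vertices. -/
structure MDSInvariant (G : SimpleGraph V) (σ : Fin n ≃ V) (mn : V → V) (i : ℕ)
    (s : MDSState V) : Prop where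
  required_iff : ∀ x, s.label x = Label.required ↔ ∃ t ∈ s.T, x = mn t
  bounded_iff : ∀ x, s.label x = Label.bounded ↔ ∀ t ∈ s.T, x ∉ closedNbhd G (mn t)
  mem_C : ∀ x, x ∈ s.C ↔ (σ.symm x : ℕ) < i ∧ s.label x = Label.required
  not_bounded : ∀ x, (σ.symm x : ℕ) < i → s.label x ≠ Label.bounded
  lt_of_mem_T : ∀ t ∈ s.T, (σ.symm t : ℕ) < i
  notMem : ∀ t ∈ s.T, ∀ u ∈ s.T, σ.symm u < σ.symm t → t ∉ closedNbhd G (mn u)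
  le_of_notMem : ∀ t ∈ s.T, ∀ x,
    (∀ u ∈ s.T, σ.symm u < σ.symm t → x ∉ closedNbhd G (mn u)) → σ.symm t ≤ σ.symm x

/-- The hypotheses describe the state between the two halves of a round: labels and `T` have taken
vertex `i` into account, `C` has not. -/
theorem MDSInvariant.collect {i : Fin n} {s : MDSState V}
    (h1 : ∀ x, s.label x = Label.required ↔ ∃ t ∈ s.T, x = mn t)
    (h2 : ∀ x, s.label x = Label.bounded ↔ ∀ t ∈ s.T, x ∉ closedNbhd G (mn t))
    (h3 : ∀ x, x ∈ s.C ↔ (σ.symm x : ℕ) < i ∧ s.label x = Label.required)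
    (h4 : ∀ x, (σ.symm x : ℕ) < i + 1 → s.label x ≠ Label.bounded)
    (h5 : ∀ t ∈ s.T, (σ.symm t : ℕ) < i + 1)
    (h6 : ∀ t ∈ s.T, ∀ u ∈ s.T, σ.symm u < σ.symm t → t ∉ closedNbhd G (mn u))
    (h7 : ∀ t ∈ s.T, ∀ x,
      (∀ u ∈ s.T, σ.symm u < σ.symm t → x ∉ closedNbhd G (mn u)) → σ.symm t ≤ σ.symm x) :
    MDSInvariant G σ mn (i + 1) (s.collect (σ i)) := by
  classical
  have hx : ∀ x, (σ.symm x : ℕ) < i + 1 ↔ (σ.symm x : ℕ) < i ∨ x = σ i := by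
    intro x
    rw [← Equiv.symm_apply_eq, Fin.ext_iff]
    omega
  unfold MDSState.collect
  split_ifs with hr
  · refine ⟨h1, h2, fun x => ?_, h4, h5, h6, h7⟩
    rw [Finset.mem_insert, h3, hx]
    constructor
    · rintro (rfl | h)
      exacts [⟨Or.inr rfl, hr⟩, ⟨Or.inl h.1, h.2⟩]
    · rintro ⟨h | h, h'⟩
      exacts [Or.inr ⟨h, h'⟩, Or.inl h]
  · refine ⟨h1, h2, fun x => ?_, h4, h5, h6, h7⟩
    rw [h3, hx]
    constructor
    · exact fun h => ⟨Or.inl h.1, h.2⟩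
    · rintro ⟨h | rfl, h'⟩
      exacts [⟨h, h'⟩, absurd h' hr]

theorem MDSInvariant.succ (h : IsLocallyProper G σ mn) {i : Fin n} {s : MDSState V}
    (hs : MDSInvariant G σ mn i s) :
    MDSInvariant G σ mn (i + 1) ((s.trigger G mn (σ i)).collect (σ i)) := by
  classical
  have hx : ∀ x, (σ.symm x : ℕ) < i + 1 ↔ (σ.symm x : ℕ) < i ∨ x = σ i := by
    intro x
    rw [← Equiv.symm_apply_eq, Fin.ext_iff]
    omega
  obtain ⟨h1, h2, h3, h4, h5, h6, h7⟩ := hs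
  unfold MDSState.trigger
  split_ifs with hb
  -- Earlier vertices are no longer bounded, hence dominated; so a bounded `σ i` is the least
  -- undominated vertex.
  · have hle : ∀ x, (∀ t ∈ s.T, x ∉ closedNbhd G (mn t)) → i ≤ σ.symm x := fun x hx => by
      by_contra hc
      exact h4 x (not_le.1 hc) ((h2 x).2 hx)
    have hreq : ∀ x, s.label x = Label.required → s.label x ≠ Label.bounded := by
      intro x hx
      simp [hx]
    refine MDSInvariant.collect (fun x => ?_) (fun x => ?_) (fun x => ?_) (fun x hxi => ?_)
      (fun t ht => ?_) ?_ ?_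
    · by_cases hxm : x = mn (σ i)
      · simp [hxm]
      · dsimp only
        by_cases hxr : s.label x = Label.required
        · simp [hxr, (h1 x).1 hxr]
        · have : ∀ t ∈ s.T, x ≠ mn t := by simpa [h1] using hxr
          split_ifs <;> simp_all
    · dsimp only
      simp only [Finset.mem_insert, forall_eq_or_imp, ← h2]
      split_ifs with h8 h9
      · simp only [false_iff, not_and]
        rcases h8 with rfl | h8
        · exact fun hc => absurd (self_mem_closedNbhd _) hc
        · exact fun _ => hreq x h8
      · simp [h9]
      · simp [h9]
    · dsimp only
      rw [h3]
      refine and_congr_right fun hxi => ?_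
      -- Since `mn` never points backwards, a vertex already passed cannot become required later,
      -- and `C` misses none.
      have : x ≠ mn (σ i) := by
        rintro rfl
        have := h.le (σ i)
        rw [Equiv.symm_apply_apply, Fin.le_def] at this
        omega
      by_cases hxr : s.label x = Label.required
      · simp [hxr]
      · simp only [this, hxr, or_self, if_false, false_iff]
        split_ifs <;> simp_all
    · dsimp only
      rcases (hx x).1 hxi with hxi | rfl
      · have := h4 x hxi
        split_ifs <;> simp_all
      · have := closedNbhd_comm.1 (h.mem_closedNbhd (σ i))
        split_ifs <;> simp_all
    · rcases Finset.mem_insert.1 ht with rfl | ht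
      · simp
      · have := h5 t ht
        omega
    · intro t ht u hu hut
      rcases Finset.mem_insert.1 hu with rfl | hu
      · rcases Finset.mem_insert.1 ht with rfl | ht
        · exact absurd hut (lt_irrefl _)
        · have := h5 t ht
          rw [Equiv.symm_apply_apply, Fin.lt_def] at hut
          omega
      · rcases Finset.mem_insert.1 ht with rfl | ht
        · exact (h2 _).1 hb u hu
        · exact h6 t ht u hu hut
    · intro t ht x hxu
      rcases Finset.mem_insert.1 ht with rfl | ht
      · rw [Equiv.symm_apply_apply] at hxu ⊢
        exact hle x fun u hu => hxu u (Finset.mem_insert_of_mem hu) (h5 u hu)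
      · exact h7 t ht x fun u hu => hxu u (Finset.mem_insert_of_mem hu)
  · refine MDSInvariant.collect h1 h2 h3 (fun x hxi => ?_) (fun t ht => ?_) h6 h7
    · rcases (hx x).1 hxi with hxi | rfl
      exacts [h4 x hxi, hb]
    · have := h5 t ht
      omega

theorem mdsInvariant_mds (h : IsLocallyProper G σ mn) : MDSInvariant G σ mn n (MDS G σ mn) := by
  have key : ∀ i ≤ n, MDSInvariant G σ mn i
      (((List.ofFn σ).take i).foldl (fun s v => (s.trigger G mn v).collect v)
        { label := fun _ => Label.bounded, C := ∅, T := ∅ }) := by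
    intro i
    induction i with
    | zero =>
      intro _
      constructor <;> simp
    | succ i ih =>
      intro hi
      rw [List.take_succ_eq_append_getElem (by simpa using hi), List.foldl_append]
      simpa using (ih (by omega)).succ h (i := ⟨i, hi⟩)
  have := key n le_rfl
  rwa [List.take_of_length_le (by simp)] at this

theorem isTriggered_mds (h : IsLocallyProper G σ mn) :
    IsTriggered G σ mn (MDS G σ mn).C (MDS G σ mn).T := by
  obtain ⟨h1, h2, h3, h4, h5, h6, h7⟩ := mdsInvariant_mds h
  set s := MDS G σ mn
  have hC : ∀ x, x ∈ s.C ↔ ∃ t ∈ s.T, x = mn t := fun x => by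
    rw [h3, h1, and_iff_right (Fin.is_lt _)]
  refine ⟨fun x => ?_, s.T.card, fun j => σ ((s.T.map σ.symm.toEmbedding).orderEmbOfFin
    (Finset.card_map _) j), ?_, ?_, ?_, ?_, ?_⟩
  · have := mt (h2 x).2 (h4 x (Fin.is_lt _))
    push Not at this
    obtain ⟨t, ht, hx⟩ := this
    exact ⟨mn t, (hC _).2 ⟨t, ht, rfl⟩, hx⟩
  all_goals
    set t : Fin s.T.card → V := fun j => σ ((s.T.map σ.symm.toEmbedding).orderEmbOfFin
      (Finset.card_map _) j) with ht
    have hmono : StrictMono fun j => σ.symm (t j) := by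
      simp only [ht, Equiv.symm_apply_apply]
      exact OrderEmbedding.strictMono _
    have hmem : ∀ j, t j ∈ s.T := by
      intro j
      have := Finset.orderEmbOfFin_mem (s.T.map σ.symm.toEmbedding) (Finset.card_map _) j
      simpa [ht, Equiv.symm_apply_eq] using this
    have hrange : ∀ x ∈ s.T, ∃ j, t j = x := by
      intro x hx
      have := Finset.range_orderEmbOfFin (s.T.map σ.symm.toEmbedding)
        (Finset.card_map (f := σ.symm.toEmbedding))
      obtain ⟨j, hj⟩ : σ.symm x ∈ Set.range ((s.T.map σ.symm.toEmbedding).orderEmbOfFin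
          (Finset.card_map _)) := by simp [hx]
      exact ⟨j, by simp [ht, hj]⟩
  · exact hmono
  -- If the two agreed, `mn (t i)` would already dominate the later triggering vertex `t j`.
  · have : ∀ i j, i < j → mn (t i) ≠ mn (t j) := fun i j hij he => by
      refine h6 (t j) (hmem j) (t i) (hmem i) (hmono hij) ?_
      rw [he]
      exact closedNbhd_comm.1 (h.mem_closedNbhd _)
    intro i j hij
    rcases lt_trichotomy i j with hlt | rfl | hlt
    exacts [absurd hij (this i j hlt), rfl, absurd hij.symm (this j i hlt)]
  · ext x
    exact ⟨hrange x, by rintro ⟨j, rfl⟩; exact hmem j⟩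
  · ext x
    rw [Finset.mem_coe, hC]
    constructor
    · rintro ⟨u, hu, rfl⟩
      obtain ⟨j, rfl⟩ := hrange u hu
      exact ⟨j, rfl⟩
    · rintro ⟨j, rfl⟩
      exact ⟨_, hmem j, rfl⟩
  · refine fun i => ⟨fun j hj => h6 _ (hmem i) _ (hmem j) (hmono hj), fun x hx => ?_⟩
    refine h7 _ (hmem i) x fun u hu hut => ?_
    obtain ⟨j, rfl⟩ := hrange u hu
    exact hx j (hmono.lt_iff_lt.1 hut)

end MDS

/-! ### Connectedness, matching of surplus tokens, and length bounds. -/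

section Main

variable {V : Type*} {G : SimpleGraph V} {n : ℕ} {σ : Fin n ≃ V} {mn : V → V}

/-- Of two distinct adjacent vertices, replace the earlier by its image under `mn`: this is strictly
later and still equal or adjacent to the other. The sum of the positions grows until the two
coincide. -/
theorem IsLocallyProper.exists_iterate_eq (h : IsLocallyProper G σ mn) {u v : V}
    (huv : v ∈ closedNbhd G u) : ∃ p q : ℕ, mn^[p] u = mn^[q] v := by
  induction hm : 2 * n - ((σ.symm u : ℕ) + σ.symm v) using Nat.strong_induction_on
    generalizing u v with
  | _ m ih =>
    have hu := (σ.symm u).2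
    have hv := (σ.symm v).2
    rcases lt_trichotomy (σ.symm u) (σ.symm v) with hlt | heq | hlt
    · have h1 := h.lt_of_mem huv hlt
      have h2 := h.mem_closedNbhd_of_mem (self_mem_closedNbhd u) le_rfl huv hlt.le
      rw [Fin.lt_def] at h1
      obtain ⟨p, q, hpq⟩ := ih _ (by omega) h2 rfl
      exact ⟨p + 1, q, by simpa using hpq⟩
    · exact ⟨0, 0, by simpa using heq⟩
    · have huv := closedNbhd_comm.1 huv
      have h1 := h.lt_of_mem huv hlt
      have h2 := h.mem_closedNbhd_of_mem (self_mem_closedNbhd v) le_rfl huv hlt.le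
      rw [Fin.lt_def] at h1
      obtain ⟨p, q, hpq⟩ := ih _ (by omega) h2 rfl
      exact ⟨q, p + 1, by simpa using hpq.symm⟩

theorem IsLocallyProper.exists_iterate_eq_of_reachable (h : IsLocallyProper G σ mn) {u v : V}
    (huv : G.Reachable u v) : ∃ p q : ℕ, mn^[p] u = mn^[q] v := by
  obtain ⟨w⟩ := huv
  induction w with
  | nil => exact ⟨0, 0, rfl⟩
  | cons hadj _ ih =>
    obtain ⟨p, q, h1⟩ := h.exists_iterate_eq (Or.inr hadj)
    obtain ⟨p', q', h2⟩ := ih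
    refine ⟨p' + p, q + q', ?_⟩
    rw [Function.iterate_add_apply, h1, ← Function.iterate_add_apply, add_comm p',
      Function.iterate_add_apply, h2, ← Function.iterate_add_apply]

/-- The last vertex is fixed by `mn`. In a connected graph all orbits of `mn` merge, so there is no
second fixed point. -/
theorem IsLocallyProper.isMaxNeighborMap (h : IsLocallyProper G σ mn) (hG : G.Preconnected) :
    IsMaxNeighborMap G σ mn := by
  refine ⟨h.1, fun i hi hfix => ?_⟩
  have hlast : mn (σ ⟨n - 1, by omega⟩) = σ ⟨n - 1, by omega⟩ := by
    have := h.le (σ ⟨n - 1, by omega⟩)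
    rw [← Equiv.symm_apply_eq]
    refine le_antisymm ?_ (by simpa using this)
    rw [Fin.le_def]
    dsimp only
    omega
  obtain ⟨p, q, hpq⟩ := h.exists_iterate_eq_of_reachable (hG (σ i) (σ ⟨n - 1, by omega⟩))
  rw [Function.iterate_fixed hfix, Function.iterate_fixed hlast, σ.injective.eq_iff] at hpq
  rw [hpq] at hi
  dsimp only at hi
  omega

/-- Equal numbers on all components mean equal images in the multiset of components, and this
equality lifts to a matching of tokens. -/
theorem rel_of_forall_tokensOn_eq {R R' : Multiset V} {r : V → V → Prop}
    (hr : ∀ u v, G.Reachable u v → r u v) (h : ∀ c, tokensOn G R c = tokensOn G R' c) :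
    Multiset.Rel r R R' := by
  classical
  have h1 : R.map G.connectedComponentMk = R'.map G.connectedComponentMk := by
    ext c
    rw [Multiset.count_map, Multiset.count_map, ← Multiset.countP_eq_card_filter,
      ← Multiset.countP_eq_card_filter]
    convert h c using 2 <;> simp [tokensOn, eq_comm]
  rw [← Multiset.rel_eq, Multiset.rel_map] at h1
  exact h1.mono fun u _ v _ huv => hr u v (SimpleGraph.ConnectedComponent.exact huv)

theorem IsLocallyProper.exists_reconfIn (h : IsLocallyProper G σ mn) {k : ℕ}
    {D D' : Multiset V} (hD : IsDomMultiset G k D) (hD' : IsDomMultiset G k D')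
    (hc : ∀ c, tokensOn G D c = tokensOn G D' c) :
    ∃ l ≤ 4 * k * Nat.card V, ReconfIn G k l D D' := by
  classical
  have hn : Nat.card V = n := by simpa using (Nat.card_congr σ).symm
  have : Finite V := Finite.of_equiv _ σ
  have : Fintype V := Fintype.ofFinite V
  have hT := isTriggered_mds h
  set C := (MDS G σ mn).C
  obtain ⟨l, hl, R, hR⟩ := hT.exists_reconfIn h hD
  obtain ⟨l', hl', R', hR'⟩ := hT.exists_reconfIn h hD'
  -- The tokens of `C` cancel, so the surplus tokens also agree on each component; paths have fewer
  -- than `n` edges.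
  have hrel : Multiset.Rel (fun u v => ∃ p : G.Walk u v, p.length ≤ n) R R' := by
    refine rel_of_forall_tokensOn_eq (G := G) ?_ fun c => ?_
    · rintro u v ⟨p⟩
      have := p.toPath.2.length_lt
      rw [← Nat.card_eq_fintype_card, hn] at this
      exact ⟨p.toPath, this.le⟩
    · have := ((hR.tokensOn_eq c).symm.trans (hc c)).trans (hR'.tokensOn_eq c)
      simpa [tokensOn, Multiset.countP_add] using this
  obtain ⟨m, hm, hmr⟩ := exists_reconfIn_of_rel (C := C.val) (by simpa using hT.1) hrel
  have hk := hR.right.1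
  rw [Multiset.card_add] at hk
  rw [hk] at hmr
  refine ⟨l + m + l', ?_, (hR.trans hmr).trans hR'.symm⟩
  rw [hn]
  rw [Finset.card_val] at hk
  -- The total is at most `4 * C.card + R.card * n`. Absorbing the first term into `4 * k * n` needs
  -- `1 ≤ n`; without vertices everything is zero.
  rcases Nat.eq_zero_or_pos n with rfl | hpos
  · have : C.card = 0 := by
      have := C.card_le_univ
      rw [← Nat.card_eq_fintype_card, hn] at this
      omega
    simp only [this, mul_zero, Nat.le_zero] at hl hl' hm
    simp [*]
  · nlinarith [Nat.mul_le_mul_left C.card hpos]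

theorem IsDuallyChordal.reconf_iff (h : IsDuallyChordal G) {k : ℕ} {D D' : Multiset V}
    (hD : IsDomMultiset G k D) (hD' : IsDomMultiset G k D') :
    Reconf G k D D' ↔ ∀ c, tokensOn G D c = tokensOn G D' c := by
  refine ⟨fun ⟨_, hl⟩ c => hl.tokensOn_eq c, fun hc => ?_⟩
  obtain ⟨n, σ, mn, hσ⟩ := h.exists_isLocallyProper
  obtain ⟨l, -, hl⟩ := hσ.exists_reconfIn hD hD' hc
  exact ⟨l, hl⟩

theorem IsDuallyChordal.exists_reconfIn (h : IsDuallyChordal G) {k : ℕ} {D D' : Multiset V}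
    (hr : Reconf G k D D') : ∃ l ≤ 4 * k * Nat.card V, ReconfIn G k l D D' := by
  obtain ⟨n, σ, mn, hσ⟩ := h.exists_isLocallyProper
  obtain ⟨l, hl⟩ := hr
  exact hσ.exists_reconfIn hl.left hl.right hl.tokensOn_eq

theorem rel_replicate {α : Type*} {r : α → α → Prop} {R : Multiset α} {v : α}
    (h : ∀ u ∈ R, r u v) : Multiset.Rel r R (Multiset.replicate R.card v) := by
  induction R using Multiset.induction_on with
  | empty => exact Multiset.Rel.zero
  | cons a R ih =>
    rw [Multiset.card_cons, Multiset.replicate_succ]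
    exact Multiset.Rel.cons (h a (by simp)) (ih fun u hu => h u (by simp [hu]))

theorem IsTriggered.exists_reconfIn_replicate (h : IsLocallyProper G σ mn) (hG : G.Connected)
    {C T : Finset V} (hC : IsTriggered G σ mn C T) {k : ℕ} {D : Multiset V}
    (hD : IsDomMultiset G k D) (v : V) :
    ∃ l : ℕ, (l : ℕ∞) ≤ 2 * (C.card : ℕ∞) + ((k - C.card : ℕ) : ℕ∞) * G.eccent v ∧
      ReconfIn G k l D (C.val + Multiset.replicate (k - C.card) v) := by
  obtain ⟨l, hl, R, hR⟩ := hC.exists_reconfIn h hD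
  have hk := hR.right.1
  rw [Multiset.card_add] at hk
  have hkC : k - C.card = R.card := by
    rw [Finset.card_val] at hk
    omega
  have : Finite V := Finite.of_equiv _ σ
  have := hG.nonempty
  -- The eccentricity has values in `ℕ∞`; a vertex `w` that attains it turns it into the natural
  -- number `G.dist v w`.
  obtain ⟨w, hw⟩ := G.exists_edist_eq_eccent_of_finite v
  have hrel : Multiset.Rel (fun a b => ∃ p : G.Walk a b, p.length ≤ G.dist v w) R
      (Multiset.replicate R.card v) := rel_replicate fun u _ => by
    obtain ⟨p, hp⟩ := hG.exists_walk_length_eq_dist u v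
    refine ⟨p, ?_⟩
    have h1 : G.edist v u ≤ G.edist v w := hw ▸ SimpleGraph.edist_le_eccent
    rw [← (hG v u).coe_dist_eq_edist, ← (hG v w).coe_dist_eq_edist, Nat.cast_le] at h1
    rwa [hp, SimpleGraph.dist_comm]
  obtain ⟨m, hm, hmr⟩ := exists_reconfIn_of_rel (C := C.val) (by simpa using hC.1) hrel
  rw [hk] at hmr
  refine ⟨l + m, ?_, hkC ▸ hR.trans hmr⟩
  rw [hkC, ← hw, ← (hG v w).coe_dist_eq_edist]
  exact_mod_cast add_le_add hl hm

end Main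

/-! ### The program and its running time. -/

section Program

/-- Lines `0`–`3` give every vertex its own label; lines `4`–`19` treat the edges and replace the
label of one end by that of the other throughout; lines `20`–`33` count, for each label, the tokens
of both kinds on vertices with this label; lines `34`–`42` compare the numbers. -/
def componentProgram : Program :=
  [.jumpEq 3 0 4, .store 4 3 3, .succ 3, .jump 0,
    .const 3 0, .jumpEq 3 1 20, .load 4 0 3, .load 5 1 3, .load 4 4 4, .load 5 4 5, .succ 3,
    .jumpEq 4 5 5, .const 6 0, .jumpEq 6 0 5, .load 7 4 6, .jumpEq 7 4 18, .succ 6, .jump 13,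
    .store 4 6 5, .jump 16,
    .const 3 0, .jumpEq 3 2 34, .load 4 2 3, .load 4 4 4, .load 5 5 4, .succ 5, .store 5 4 5,
    .load 4 3 3, .load 4 4 4, .load 5 6 4, .succ 5, .store 6 4 5, .succ 3, .jump 21,
    .const 3 0, .jumpEq 3 0 42, .load 4 5 3, .load 5 6 3, .jumpEq 4 5 40, .halt false,
    .succ 3, .jump 35, .halt true]

/-- Within `t` steps the program gets from `c` to a configuration that satisfies `Q`. -/
def Reaches (c : Config) (t : ℕ) (Q : Config → Prop) : Prop :=
  ∃ s ≤ t, Q ((step componentProgram)^[s] c)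

theorem Reaches.of_self {c : Config} {t : ℕ} {Q : Config → Prop} (h : Q c) : Reaches c t Q :=
  ⟨0, Nat.zero_le _, h⟩

/-- Symbolic execution: `hc` is usually `rfl`. A block ends at a conditional jump, whose line is
left as an `if` and resolved afterwards. -/
theorem Reaches.head (k : ℕ) {c c' : Config} {t t' : ℕ} {Q : Config → Prop}
    (hc : (step componentProgram)^[k] c = c') (h : Reaches c' t Q) (ht : k + t ≤ t') :
    Reaches c t' Q := by
  obtain ⟨s, hs, hQ⟩ := h
  exact ⟨s + k, by omega, by rwa [Function.iterate_add_apply, hc]⟩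

theorem Reaches.bind {c : Config} {t t' t'' : ℕ} {Q Q' : Config → Prop} (h : Reaches c t Q)
    (h' : ∀ c', Q c' → Reaches c' t' Q') (ht : t + t' ≤ t'') : Reaches c t'' Q' := by
  obtain ⟨s, hs, hQ⟩ := h
  exact Reaches.head s rfl (h' _ hQ) (by omega)

variable {n : ℕ} {E : List (Fin n × Fin n)} {S T : List (Fin n)}

/-- The registers and arrays that hold the input are as in the initial configuration. -/
structure HoldsInput (n : ℕ) (E : List (Fin n × Fin n)) (S T : List (Fin n)) (r : ℕ → ℕ)
    (M : ℕ → ℕ → ℕ) : Prop where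
  reg0 : r 0 = n
  reg1 : r 1 = E.length
  reg2 : r 2 = S.length
  mem0 : M 0 = arrayOf (E.map fun e => (e.1 : ℕ))
  mem1 : M 1 = arrayOf (E.map fun e => (e.2 : ℕ))
  mem2 : M 2 = arrayOf (S.map fun v : Fin n => (v : ℕ))
  mem3 : M 3 = arrayOf (T.map fun v : Fin n => (v : ℕ))

theorem HoldsInput.updateReg {r : ℕ → ℕ} {M : ℕ → ℕ → ℕ} (h : HoldsInput n E S T r M) (i x : ℕ)
    (hi : 3 ≤ i) : HoldsInput n E S T (Function.update r i x) M := by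
  obtain ⟨h0, h1, h2, h3, h4, h5, h6⟩ := h
  refine ⟨?_, ?_, ?_, h3, h4, h5, h6⟩ <;> rwa [Function.update_of_ne (by omega)]

theorem HoldsInput.updateMem {r : ℕ → ℕ} {M : ℕ → ℕ → ℕ} (h : HoldsInput n E S T r M) (i : ℕ)
    (f : ℕ → ℕ) (hi : 4 ≤ i) : HoldsInput n E S T r (Function.update M i f) := by
  obtain ⟨h0, h1, h2, h3, h4, h5, h6⟩ := h
  refine ⟨h0, h1, h2, ?_, ?_, ?_, ?_⟩ <;> rwa [Function.update_of_ne (by omega)]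

theorem arrayOf_map {α : Type*} (f : α → ℕ) (L : List α) {i : ℕ} (hi : i < L.length) :
    arrayOf (L.map f) i = f L[i] := by
  simp [arrayOf, hi]

theorem reaches_initial_labels {i : ℕ} {r : ℕ → ℕ} {M : ℕ → ℕ → ℕ} (h : HoldsInput n E S T r M)
    (hi : i ≤ n) (hr : r 3 = i) (h4 : ∀ x < i, M 4 x = x) (h5 : M 5 = fun _ => 0)
    (h6 : M 6 = fun _ => 0) :
    Reaches ⟨0, r, M⟩ (4 * (n - i) + 1) fun c => c.line = 4 ∧ HoldsInput n E S T c.reg c.mem ∧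
      (∀ x < n, c.mem 4 x = x) ∧ c.mem 5 = (fun _ => 0) ∧ c.mem 6 = fun _ => 0 := by
  induction hm : n - i generalizing i r M with
  | zero =>
    obtain rfl : i = n := by omega
    refine Reaches.head 1 (c' := ⟨if r 3 = r 0 then 4 else 1, r, M⟩) rfl (t := 0) ?_ (by omega)
    rw [if_pos (by rw [hr, h.reg0])]
    exact Reaches.of_self ⟨rfl, h, h4, h5, h6⟩
  | succ m ih =>
    refine Reaches.head 1 (c' := ⟨if r 3 = r 0 then 4 else 1, r, M⟩) rfl
      (t := 4 * m + 4) ?_ (by omega)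
    rw [if_neg (by rw [hr, h.reg0]; omega)]
    refine Reaches.head 3 (c' := ⟨0, Function.update r 3 (r 3 + 1),
      Function.update M 4 (Function.update (M 4) (r 3) (r 3))⟩) rfl (t := 4 * m + 1) ?_ (by omega)
    refine ih (i := i + 1) ((h.updateReg 3 _ le_rfl).updateMem 4 _ le_rfl) (by omega) (by simp [hr])
      (fun x hx => ?_) ?_ ?_ (by omega)
    · rw [Function.update_self, hr]
      by_cases hxi : x = i
      · simp [hxi]
      · rw [Function.update_of_ne hxi]
        exact h4 x (by omega)
    · rwa [Function.update_of_ne (by decide)]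
    · rwa [Function.update_of_ne (by decide)]

theorem reaches_relabel {a b j i : ℕ} {r : ℕ → ℕ} {M : ℕ → ℕ → ℕ} (h : HoldsInput n E S T r M)
    (hj : j ≤ n) (hr3 : r 3 = i) (hr4 : r 4 = a) (hr5 : r 5 = b) (hr6 : r 6 = j)
    (h5 : M 5 = fun _ => 0) (h6 : M 6 = fun _ => 0) :
    Reaches ⟨13, r, M⟩ (7 * (n - j) + 1) fun c => c.line = 5 ∧ HoldsInput n E S T c.reg c.mem ∧
      c.reg 3 = i ∧ (∀ x < n, c.mem 4 x = if j ≤ x ∧ M 4 x = a then b else M 4 x) ∧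
      c.mem 5 = (fun _ => 0) ∧ c.mem 6 = fun _ => 0 := by
  induction hm : n - j generalizing j r M with
  | zero =>
    obtain rfl : j = n := by omega
    refine Reaches.head 1 (c' := ⟨if r 6 = r 0 then 5 else 14, r, M⟩) rfl (t := 0) ?_ (by omega)
    rw [if_pos (by rw [hr6, h.reg0])]
    exact Reaches.of_self ⟨rfl, h, hr3, fun x hx => by simp [hx.not_ge], h5, h6⟩
  | succ m ih =>
    -- Both outcomes of the test meet here; `f` is the label array after cell `j` has been treated.
    have hnext : ∀ f : ℕ → ℕ, f j = (if M 4 j = a then b else M 4 j) →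
        (∀ x, x ≠ j → f x = M 4 x) →
        Reaches ⟨16, Function.update r 7 (M 4 (r 6)), Function.update M 4 f⟩ (7 * m + 3)
        fun c => c.line = 5 ∧ HoldsInput n E S T c.reg c.mem ∧
          c.reg 3 = i ∧ (∀ x < n, c.mem 4 x = if j ≤ x ∧ M 4 x = a then b else M 4 x) ∧
          c.mem 5 = (fun _ => 0) ∧ c.mem 6 = fun _ => 0 := by
      intro f hf hf'
      refine Reaches.head 2 (c' := ⟨13, Function.update (Function.update r 7 (M 4 (r 6))) 6
        (r 6 + 1), Function.update M 4 f⟩) rfl ((ih (j := j + 1)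
        (((h.updateReg 7 _ (by omega)).updateReg 6 _ (by omega)).updateMem 4 _ le_rfl)
        (by omega) (by simpa using hr3) (by simpa using hr4) (by simpa using hr5)
        (by simp [hr6]) (by simpa using h5) (by simpa using h6) (by omega)).bind (t' := 0) ?_ le_rfl)
        (by omega)
      rintro c ⟨h1, h2, h3, h4, h5', h6'⟩
      refine Reaches.of_self ⟨h1, h2, h3, fun x hx => ?_, h5', h6'⟩
      rw [h4 x hx, Function.update_self]
      by_cases hxj : x = j
      · subst hxj
        simp [hf]
      · rw [hf' x hxj]
        exact if_congr (and_congr_left' (by omega)) rfl rfl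
    refine Reaches.head 1 (c' := ⟨if r 6 = r 0 then 5 else 14, r, M⟩) rfl
      (t := 7 * m + 7) ?_ (by omega)
    rw [if_neg (by rw [hr6, h.reg0]; omega)]
    refine Reaches.head 2 (c' := ⟨if M 4 (r 6) = r 4 then 18 else 16,
      Function.update r 7 (M 4 (r 6)), M⟩) rfl (t := 7 * m + 5) ?_ (by omega)
    rw [hr6, hr4]
    split_ifs with hja
    · refine Reaches.head 2 (c' := ⟨16, Function.update r 7 (M 4 (r 6)),
        Function.update M 4 (Function.update (M 4) (r 6) (r 5))⟩) (by rw [← hr6]; rfl)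
        (hnext _ (by simp [hr6, hr5, hja]) fun x hx => by
          rw [hr6, Function.update_of_ne hx]) (by omega)
    · have := hnext (M 4) (by simp [hja]) fun x hx => rfl
      rw [Function.update_eq_self, hr6] at this
      exact Reaches.head 0 rfl this (by omega)

/-- Two vertices with the same label are connected, and the labels agree on the first `i` edges. -/
structure IsLabeling (G : SimpleGraph (Fin n)) (E : List (Fin n × Fin n)) (i : ℕ)
    (L : Fin n → ℕ) : Prop where
  lt : ∀ v, L v < n
  reachable : ∀ u v, L u = L v → G.Reachable u v
  eq_of_mem : ∀ e ∈ E.take i, L e.1 = L e.2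

/-- The number of distinct labels pays for the relabelling passes: an edge costs `7` steps by
itself, and a further `7 * n + 2` only if its ends have different labels, in which case a label
disappears. -/
theorem reaches_labels {G : SimpleGraph (Fin n)} (hE : ∀ e ∈ E, G.Adj e.1 e.2) {i : ℕ}
    {r : ℕ → ℕ} {M : ℕ → ℕ → ℕ} (h : HoldsInput n E S T r M) (hi : i ≤ E.length) (hr3 : r 3 = i)
    (hL : IsLabeling G E i fun v => M 4 v)
    (h5 : M 5 = fun _ => 0) (h6 : M 6 = fun _ => 0) :
    Reaches ⟨5, r, M⟩ (7 * (E.length - i) +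
        (Finset.univ.image fun v : Fin n => M 4 v).card * (7 * n + 2) + 1)
      fun c => c.line = 20 ∧ HoldsInput n E S T c.reg c.mem ∧
        IsLabeling G E E.length (fun v => c.mem 4 v) ∧
        c.mem 5 = (fun _ => 0) ∧ c.mem 6 = fun _ => 0 := by
  induction hm : E.length - i generalizing i r M with
  | zero =>
    obtain rfl : i = E.length := by omega
    refine Reaches.head 1 (c' := ⟨if r 3 = r 1 then 20 else 6, r, M⟩) rfl (t := 0) ?_ (by omega)
    rw [if_pos (by rw [hr3, h.reg1])]
    exact Reaches.of_self ⟨rfl, h, hL, h5, h6⟩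
  | succ m ih =>
    have hiE : i < E.length := by omega
    set u := (E[i]).1 with hu
    set v := (E[i]).2 with hv
    have hM0 : M 0 (r 3) = u := by rw [h.mem0, hr3, arrayOf_map _ _ hiE]
    have hM1 : M 1 (r 3) = v := by rw [h.mem1, hr3, arrayOf_map _ _ hiE]
    have huv : G.Reachable u v := (hE _ (List.getElem_mem hiE)).reachable
    have htake : ∀ e, e ∈ E.take (i + 1) ↔ e ∈ E.take i ∨ e = E[i] := fun e => by
      rw [List.take_succ_eq_append_getElem hiE, List.mem_append, List.mem_singleton]
    refine Reaches.head 1 (c' := ⟨if r 3 = r 1 then 20 else 6, r, M⟩) rfl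
      (t := 7 * m + (Finset.univ.image fun v : Fin n => M 4 v).card * (7 * n + 2) + 7) ?_ (by omega)
    rw [if_neg (by rw [hr3, h.reg1]; omega)]
    refine Reaches.head 5 (c' := ⟨11, Function.update (Function.update (Function.update
      (Function.update (Function.update r 4 (M 0 (r 3))) 5 (M 1 (r 3))) 4 (M 4 (M 0 (r 3))))
      5 (M 4 (M 1 (r 3)))) 3 (r 3 + 1), M⟩) rfl
      (t := 7 * m + (Finset.univ.image fun v : Fin n => M 4 v).card * (7 * n + 2) + 2) ?_ (by omega)
    rw [hM0, hM1]
    set r' := Function.update (Function.update (Function.update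
      (Function.update (Function.update r 4 (u : ℕ)) 5 (v : ℕ)) 4 (M 4 u))
      5 (M 4 v)) 3 (r 3 + 1) with hr'
    have h' : HoldsInput n E S T r' M := ((((h.updateReg 4 _ (by omega)).updateReg 5 _
      (by omega)).updateReg 4 _ (by omega)).updateReg 5 _ (by omega)).updateReg 3 _ le_rfl
    have hr3' : r' 3 = i + 1 := by simp [hr', hr3]
    have hr4' : r' 4 = M 4 u := by simp [hr']
    have hr5' : r' 5 = M 4 v := by simp [hr']
    refine Reaches.head 1 (c' := ⟨if r' 4 = r' 5 then 5 else 12, r', M⟩) rfl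
      (t := 7 * m + (Finset.univ.image fun v : Fin n => M 4 v).card * (7 * n + 2) + 1) ?_ (by omega)
    rw [hr4', hr5']
    split_ifs with hab
    · refine ih h' (by omega) hr3' ⟨hL.lt, hL.reachable, fun e he => ?_⟩ h5 h6 (by omega)
      rcases (htake e).1 he with he | rfl
      exacts [hL.eq_of_mem e he, hab]
    · have hpos : 1 ≤ (Finset.univ.image fun v : Fin n => M 4 v).card :=
        Finset.card_pos.2 ⟨M 4 u, Finset.mem_image_of_mem _ (Finset.mem_univ u)⟩
      obtain ⟨q, hq⟩ := Nat.exists_eq_add_of_le' hpos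
      rw [hq]
      refine Reaches.head 1 (c' := ⟨13, Function.update r' 6 0, M⟩) rfl
        ((reaches_relabel (i := i + 1) (a := M 4 u) (b := M 4 v) (h'.updateReg 6 0 (by omega)) (Nat.zero_le n)
          (by rwa [Function.update_of_ne (by decide)])
          (by rwa [Function.update_of_ne (by decide)])
          (by rwa [Function.update_of_ne (by decide)])
          (Function.update_self _ _ _) h5 h6).bind (t' := 7 * m + q * (7 * n + 2) + 1) ?_ le_rfl)
        (by rw [add_mul]; omega)
      rintro ⟨l, r'', M''⟩ ⟨h1, h2, h3, h4, h5', h6'⟩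
      dsimp only at h1 h2 h3 h4 h5' h6'
      subst h1
      have hL' : (fun x : Fin n => M'' 4 x) = fun x : Fin n =>
          if M 4 x = M 4 u then M 4 v else M 4 x := by
        ext x
        simp [h4 x x.2]
      -- The label that `u` had is gone and no new one has appeared.
      have hcard : (Finset.univ.image fun x : Fin n => M'' 4 x).card ≤ q := by
        have hsub : (Finset.univ.image fun x : Fin n => M'' 4 x) ⊆
            (Finset.univ.image fun x : Fin n => M 4 x).erase (M 4 u) := by
          rw [hL']
          intro y hy
          obtain ⟨x, -, rfl⟩ := Finset.mem_image.1 hy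
          rw [Finset.mem_erase]
          split_ifs with hx
          · exact ⟨Ne.symm hab, Finset.mem_image_of_mem _ (Finset.mem_univ v)⟩
          · exact ⟨hx, Finset.mem_image_of_mem _ (Finset.mem_univ x)⟩
        have := Finset.card_le_card hsub
        rw [Finset.card_erase_of_mem (Finset.mem_image_of_mem _ (Finset.mem_univ u))] at this
        omega
      refine (ih (i := i + 1) h2 (by omega) h3 ?_ h5' h6' (by omega)).bind (t' := 0)
        (fun c hc => Reaches.of_self hc) ?_
      · rw [hL']
        refine ⟨fun x => ?_, fun x y hxy => ?_, fun e he => ?_⟩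
        · split_ifs
          exacts [hL.lt v, hL.lt x]
        · split_ifs at hxy with hx hy hy
          · exact hL.reachable x y (hx.trans hy.symm)
          · exact ((hL.reachable x u hx).trans huv).trans (hL.reachable v y hxy)
          · exact ((hL.reachable x v hxy).trans huv.symm).trans (hL.reachable u y hy.symm)
          · exact hL.reachable x y hxy
        · rcases (htake e).1 he with he | rfl
          · rw [hL.eq_of_mem e he]
          · rw [if_pos rfl, ← hv]
            split_ifs <;> rfl
      · have := Nat.mul_le_mul_right (7 * n + 2) hcard
        omega

theorem count_take_succ_map {α : Type*} (f : α → ℕ) (L : List α) {i : ℕ} (hi : i < L.length) :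
    (fun x => ((L.take (i + 1)).map f).count x) = Function.update
      (fun x => ((L.take i).map f).count x) (f L[i]) (((L.take i).map f).count (f L[i]) + 1) := by
  ext x
  rw [List.take_succ_eq_append_getElem hi, List.map_append, List.count_append, Function.update_apply]
  split_ifs with hx
  · simp [hx]
  · simp [Ne.symm hx]

/-- As the lists have equal length, one counter serves both. -/
theorem reaches_counts (hST : T.length = S.length) {L : Fin n → ℕ} {i : ℕ}
    {r : ℕ → ℕ} {M : ℕ → ℕ → ℕ} (h : HoldsInput n E S T r M) (hi : i ≤ S.length) (hr3 : r 3 = i)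
    (h4 : ∀ v : Fin n, M 4 v = L v) (h5 : M 5 = fun x => ((S.take i).map L).count x)
    (h6 : M 6 = fun x => ((T.take i).map L).count x) :
    Reaches ⟨21, r, M⟩ (13 * (S.length - i) + 1)
      fun c => c.line = 34 ∧ HoldsInput n E S T c.reg c.mem ∧
        c.mem 5 = (fun x => (S.map L).count x) ∧ c.mem 6 = fun x => (T.map L).count x := by
  induction hm : S.length - i generalizing i r M with
  | zero =>
    obtain rfl : i = S.length := by omega
    refine Reaches.head 1 (c' := ⟨if r 3 = r 2 then 34 else 22, r, M⟩) rfl (t := 0) ?_ (by omega)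
    rw [if_pos (by rw [hr3, h.reg2])]
    rw [List.take_of_length_le le_rfl] at h5
    rw [List.take_of_length_le hST.le] at h6
    exact Reaches.of_self ⟨rfl, h, h5, h6⟩
  | succ m ih =>
    have hiS : i < S.length := by omega
    have hiT : i < T.length := by omega
    have hM2 : M 2 (r 3) = S[i] := by rw [h.mem2, hr3, arrayOf_map _ _ hiS]
    have hM3 : M 3 (r 3) = T[i] := by rw [h.mem3, hr3, arrayOf_map _ _ hiT]
    refine Reaches.head 1 (c' := ⟨if r 3 = r 2 then 34 else 22, r, M⟩) rfl
      (t := 13 * m + 13) ?_ (by omega)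
    rw [if_neg (by rw [hr3, h.reg2]; omega)]
    set a := M 4 (M 2 (r 3)) with ha
    set b := M 4 (M 3 (r 3)) with hb
    refine Reaches.head 5 (c' := ⟨27, Function.update (Function.update (Function.update
      (Function.update r 4 (M 2 (r 3))) 4 a) 5 (M 5 a)) 5 (M 5 a + 1),
      Function.update M 5 (Function.update (M 5) a (M 5 a + 1))⟩) rfl (t := 13 * m + 8) ?_ (by omega)
    set r₁ := Function.update (Function.update (Function.update
      (Function.update r 4 (M 2 (r 3))) 4 a) 5 (M 5 a)) 5 (M 5 a + 1) with hr₁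
    set M₁ := Function.update M 5 (Function.update (M 5) a (M 5 a + 1)) with hM₁
    refine Reaches.head 7 (c' := ⟨21, Function.update (Function.update (Function.update
      (Function.update (Function.update r₁ 4 (M 3 (r 3))) 4 b) 5 (M 6 b)) 5 (M 6 b + 1)) 3
        (r 3 + 1),
      Function.update M₁ 6 (Function.update (M 6) b (M 6 b + 1))⟩) rfl (t := 13 * m + 1) ?_
      (by omega)
    refine ih (i := i + 1) ?_ (by omega) (by simp [hr3]) (fun v => by simpa [hM₁] using h4 v)
      ?_ ?_ (by omega)
    · exact ((((((((((h.updateReg 4 _ (by omega)).updateReg 4 _ (by omega)).updateReg 5 _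
        (by omega)).updateReg 5 _ (by omega)).updateReg 4 _ (by omega)).updateReg 4 _
        (by omega)).updateReg 5 _ (by omega)).updateReg 5 _ (by omega)).updateReg 3 _
        (by omega)).updateMem 5 _ (by omega)).updateMem 6 _ (by omega)
    · rw [Function.update_of_ne (by decide), hM₁, Function.update_self, count_take_succ_map _ _ hiS,
        h5, ha, hM2, h4]
    · rw [Function.update_self, count_take_succ_map _ _ hiT, h6, hb, hM3, h4]

theorem reaches_compare {f g : ℕ → ℕ} {i : ℕ} {r : ℕ → ℕ} {M : ℕ → ℕ → ℕ}
    (h : HoldsInput n E S T r M) (hi : i ≤ n) (hr3 : r 3 = i) (h5 : M 5 = f) (h6 : M 6 = g)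
    (heq : ∀ x < i, f x = g x) :
    Reaches ⟨35, r, M⟩ (6 * (n - i) + 1) fun c => ∃ b : Bool,
      componentProgram[c.line]? = some (Instr.halt b) ∧ (b = true ↔ ∀ x < n, f x = g x) := by
  induction hm : n - i generalizing i r M with
  | zero =>
    obtain rfl : i = n := by omega
    refine Reaches.head 1 (c' := ⟨if r 3 = r 0 then 42 else 36, r, M⟩) rfl (t := 0) ?_ (by omega)
    rw [if_pos (by rw [hr3, h.reg0])]
    exact Reaches.of_self ⟨true, rfl, by simpa using heq⟩
  | succ m ih =>
    refine Reaches.head 1 (c' := ⟨if r 3 = r 0 then 42 else 36, r, M⟩) rfl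
      (t := 6 * m + 6) ?_ (by omega)
    rw [if_neg (by rw [hr3, h.reg0]; omega)]
    refine Reaches.head 3 (c' := ⟨if M 5 (r 3) = M 6 (r 3) then 40 else 39,
      Function.update (Function.update r 4 (M 5 (r 3))) 5 (M 6 (r 3)), M⟩) rfl
      (t := 6 * m + 3) ?_ (by omega)
    rw [h5, h6, hr3]
    split_ifs with hfg
    · refine Reaches.head 2 (c' := ⟨35, Function.update (Function.update (Function.update r 4 (f i))
        5 (g i)) 3 (r 3 + 1), M⟩) rfl (ih (i := i + 1) (((h.updateReg 4 _ (by omega)).updateReg 5 _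
        (by omega)).updateReg 3 _ le_rfl) (by omega) (by simp [hr3]) h5 h6 (fun x hx => ?_)
        (by omega)) (by omega)
      rcases Nat.lt_succ_iff_lt_or_eq.1 hx with hx | rfl
      exacts [heq x hx, hfg]
    · refine Reaches.of_self ⟨false, rfl, ?_⟩
      simp only [Bool.false_eq_true, false_iff, not_forall]
      exact ⟨i, by omega, hfg⟩

theorem IsLabeling.eq_of_reachable {G : SimpleGraph (Fin n)} (hE : ListsEdges G E) {L : Fin n → ℕ}
    (hL : IsLabeling G E E.length L) {u v : Fin n} (h : G.Reachable u v) : L u = L v := by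
  obtain ⟨w⟩ := h
  induction w with
  | nil => rfl
  | @cons a b _ hadj _ ih =>
    refine Eq.trans ?_ ih
    obtain ⟨e, he, heq⟩ := List.mem_map.1 ((hE.2 s(a, b)).2 hadj)
    have := hL.eq_of_mem e (by rwa [List.take_of_length_le le_rfl])
    rcases Sym2.eq_iff.1 heq with ⟨h1, h2⟩ | ⟨h1, h2⟩
    · rwa [h1, h2] at this
    · rw [h1, h2] at this
      exact this.symm

/-- After all edges the labels correspond to the components, so the count of a label is the number
of tokens on its component. -/
theorem IsLabeling.forall_count_eq_iff {G : SimpleGraph (Fin n)} (hE : ListsEdges G E)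
    {L : Fin n → ℕ} (hL : IsLabeling G E E.length L) :
    (∀ x < n, (S.map L).count x = (T.map L).count x) ↔
      ∀ c, tokensOn G (S : Multiset (Fin n)) c = tokensOn G (T : Multiset (Fin n)) c := by
  classical
  have key : ∀ (A : List (Fin n)) (u : Fin n), (A.map L).count (L u) =
      tokensOn G (A : Multiset (Fin n)) (G.connectedComponentMk u) := by
    intro A u
    rw [List.count_eq_countP, List.countP_map, tokensOn, Multiset.coe_countP]
    refine List.countP_congr fun v _ => ?_
    simp only [Function.comp_apply, beq_iff_eq, decide_eq_true_eq, SimpleGraph.ConnectedComponent.eq]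
    exact ⟨hL.reachable v u, hL.eq_of_reachable hE⟩
  constructor
  · intro h c
    induction c using SimpleGraph.ConnectedComponent.ind with
    | h u => rw [← key, ← key, h _ (hL.lt u)]
  · intro h x _
    by_cases hx : ∃ u, L u = x
    · obtain ⟨u, rfl⟩ := hx
      rw [key, key, h]
    -- A number that labels no vertex has count zero on both sides.
    · rw [List.count_eq_zero_of_not_mem, List.count_eq_zero_of_not_mem] <;>
      · intro hc
        obtain ⟨u, -, hu⟩ := List.mem_map.1 hc
        exact hx ⟨u, hu⟩

theorem ListsEdges.length_le {G : SimpleGraph (Fin n)} (hE : ListsEdges G E) :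
    E.length ≤ n ^ 2 := by
  have := hE.1.of_map.length_le_card
  rwa [Fintype.card_prod, Fintype.card_fin, ← sq] at this

theorem exists_haltsIn_componentProgram {G : SimpleGraph (Fin n)} (hE : ListsEdges G E)
    (hST : T.length = S.length) :
    ∃ t ≤ 40 * (n ^ 2 + S.length * n + 1), ∃ b : Bool,
      HaltsIn componentProgram (inputConfig n E S T) t b ∧ (b = true ↔
        ∀ c, tokensOn G (S : Multiset (Fin n)) c = tokensOn G (T : Multiset (Fin n)) c) := by
  have hadj : ∀ e ∈ E, G.Adj e.1 e.2 := fun e he => (hE.2 _).1 (List.mem_map_of_mem he)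
  have hin : HoldsInput n E S T (inputConfig n E S T).reg (inputConfig n E S T).mem :=
    ⟨rfl, rfl, rfl, rfl, rfl, by simp [inputConfig, List.map_eq_flatMap],
      by simp [inputConfig, List.map_eq_flatMap]⟩
  have hlen := hE.length_le
  -- The token loop costs a multiple of `S.length`; without vertices there are no tokens.
  have hS : S.length ≤ S.length * n := by
    rcases Nat.eq_zero_or_pos n with rfl | hn
    · cases S with
      | nil => simp
      | cons v _ => exact v.elim0
    · exact Nat.le_mul_of_pos_right _ hn
  have hn : n ≤ n ^ 2 := Nat.le_self_pow two_ne_zero n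
  have main : Reaches (inputConfig n E S T) (40 * (n ^ 2 + S.length * n + 1)) fun c => ∃ b : Bool,
      componentProgram[c.line]? = some (Instr.halt b) ∧ (b = true ↔
        ∀ c, tokensOn G (S : Multiset (Fin n)) c = tokensOn G (T : Multiset (Fin n)) c) := by
    refine (reaches_initial_labels hin (Nat.zero_le n) rfl (by simp) rfl rfl).bind
      (t' := 36 * n ^ 2 + 36 * S.length + 6) ?_ (by omega)
    rintro ⟨l, r, M⟩ ⟨rfl, h, h4, h5, h6⟩
    dsimp only at h h4 h5 h6
    have hcard : (Finset.univ.image fun v : Fin n => M 4 v).card ≤ n := by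
      simpa using Finset.card_image_le (s := Finset.univ) (f := fun v : Fin n => M 4 v)
    have hprod := Nat.mul_le_mul_right (7 * n + 2) hcard
    rw [show n * (7 * n + 2) = 7 * n ^ 2 + 2 * n by ring] at hprod
    refine Reaches.head 1 (c' := ⟨5, Function.update r 3 0, M⟩) rfl ((reaches_labels hadj (i := 0)
      (h.updateReg 3 _ le_rfl) (Nat.zero_le _) (Function.update_self _ _ _)
      ⟨fun v => by rw [h4 v v.2]; exact v.2, fun u v huv => ?_, by simp⟩ h5 h6).bind
      (t' := 13 * S.length + 6 * n + 4) ?_ le_rfl) (by omega)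
    · rw [h4 u u.2, h4 v v.2] at huv
      rw [Fin.ext huv]
    rintro ⟨l, r, M⟩ ⟨rfl, h, hL, h5, h6⟩
    dsimp only at h hL h5 h6
    refine Reaches.head 1 (c' := ⟨21, Function.update r 3 0, M⟩) rfl ((reaches_counts hST (i := 0)
      (h.updateReg 3 _ le_rfl) (Nat.zero_le _) (Function.update_self _ _ _) (fun _ => rfl)
      (by simpa using h5) (by simpa using h6)).bind (t' := 6 * n + 2) ?_ le_rfl) (by omega)
    rw [← hL.forall_count_eq_iff hE]
    rintro ⟨l, r, M⟩ ⟨rfl, h, h5, h6⟩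
    dsimp only at h h5 h6
    exact Reaches.head 1 (c' := ⟨35, Function.update r 3 0, M⟩) rfl (reaches_compare
      (h.updateReg 3 _ le_rfl) (Nat.zero_le _) (Function.update_self _ _ _) h5 h6 (by simp))
      (by omega)
  obtain ⟨t, ht, b, hb, hb'⟩ := main
  exact ⟨t, ht, b, hb, hb'⟩

end Program

end DomReconf

theorem mainTheorem1 :
    -- the decision problem is solved in time `O(n² + k n)`, hence `O(n²)` if `k ≤ n`
    (∃ (P : DomReconf.Program) (c : ℕ),
      ∀ (n k : ℕ) (G : SimpleGraph (Fin n)) (E : List (Fin n × Fin n)) (S T : List (Fin n)),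
        DomReconf.IsDuallyChordal G → DomReconf.ListsEdges G E →
        DomReconf.IsDomMultiset G k (S : Multiset (Fin n)) →
        DomReconf.IsDomMultiset G k (T : Multiset (Fin n)) →
        ∃ t ≤ c * (n ^ 2 + k * n + 1), ∃ b : Bool,
          DomReconf.HaltsIn P (DomReconf.inputConfig n E S T) t b ∧
          (b = true ↔ DomReconf.Reconf G k (S : Multiset (Fin n)) (T : Multiset (Fin n)))) ∧
    -- yes-instances are those with the same number of tokens on each component, and they have
    -- sequences of at most `4 k n` slides
    (∀ (V : Type*) (G : SimpleGraph V) (k : ℕ) (Ds Dt : Multiset V),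
      DomReconf.IsDuallyChordal G →
      DomReconf.IsDomMultiset G k Ds → DomReconf.IsDomMultiset G k Dt →
      (DomReconf.Reconf G k Ds Dt ↔
        ∀ c : G.ConnectedComponent, DomReconf.tokensOn G Ds c = DomReconf.tokensOn G Dt c) ∧
      (DomReconf.Reconf G k Ds Dt →
        ∃ l ≤ 4 * k * Nat.card V, DomReconf.ReconfIn G k l Ds Dt)) ∧
    -- a suitable ordering exists on every connected dually chordal graph
    (∀ (V : Type*) (G : SimpleGraph V), DomReconf.IsDuallyChordal G → G.Connected →
      ∃ (n : ℕ) (σ : Fin n ≃ V) (mn : V → V), DomReconf.IsMaxNeighborMap G σ mn) ∧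
    -- the canonical set; reaching it, and gathering the other tokens at a central vertex
    (∀ (V : Type*) (G : SimpleGraph V) (n : ℕ) (σ : Fin n ≃ V) (mn : V → V), G.Connected →
      DomReconf.IsMaxNeighborMap G σ mn →
      DomReconf.IsTriggered G σ mn (DomReconf.MDS G σ mn).C (DomReconf.MDS G σ mn).T ∧
      DomReconf.IsMinDominating G (DomReconf.MDS G σ mn).C ∧
      ∀ (k : ℕ) (D : Multiset V), DomReconf.IsDomMultiset G k D →
        (∃ (l : ℕ) (D' : Multiset V), l ≤ 2 * (DomReconf.MDS G σ mn).C.card ∧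
          (DomReconf.MDS G σ mn).C.val ≤ D' ∧ DomReconf.ReconfIn G k l D D') ∧
        ∀ v ∈ G.center, ∃ l : ℕ,
          (l : ℕ∞) ≤ 2 * ((DomReconf.MDS G σ mn).C.card : ℕ∞) +
            ((k - (DomReconf.MDS G σ mn).C.card : ℕ) : ℕ∞) * G.eccent v ∧
          DomReconf.ReconfIn G k l D ((DomReconf.MDS G σ mn).C.val +
            Multiset.replicate (k - (DomReconf.MDS G σ mn).C.card) v)) ∧
    -- trees and interval graphs are dually chordal
    (∀ (V : Type*) [Finite V] (G : SimpleGraph V), G.IsTree → DomReconf.IsDuallyChordal G) ∧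
    (∀ (V : Type*) [Finite V] (G : SimpleGraph V),
      DomReconf.IsIntervalGraph G → DomReconf.IsDuallyChordal G) := by
  refine ⟨⟨DomReconf.componentProgram, 40, fun n k G E S T hG hE hS hT => ?_⟩,
    fun V G k Ds Dt hG hs ht => ⟨hG.reconf_iff hs ht, hG.exists_reconfIn⟩,
    fun V G hG hc => ?_, fun V G n σ mn hc hσ => ?_, fun V _ G h => DomReconf.IsTree.isDuallyChordal h,
    fun V _ G h => h.isDuallyChordal⟩
  · obtain rfl : S.length = k := hS.1
    obtain ⟨t, ht, b, hb, hb'⟩ := DomReconf.exists_haltsIn_componentProgram hE hT.1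
    exact ⟨t, ht, b, hb, hb'.trans (hG.reconf_iff hS hT).symm⟩
  · obtain ⟨n, σ, mn, h⟩ := hG.exists_isLocallyProper
    exact ⟨n, σ, mn, h.isMaxNeighborMap hc.preconnected⟩
  · have h := hσ.isLocallyProper
    have hT := DomReconf.isTriggered_mds h
    refine ⟨hT, hT.isMinDominating h, fun k D hD =>
      ⟨?_, fun v _ => hT.exists_reconfIn_replicate h hc hD v⟩⟩
    obtain ⟨l, hl, R, hR⟩ := hT.exists_reconfIn h hD
    exact ⟨l, _, hl, Multiset.le_add_right _ _, hR⟩
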